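/- Let $(W,S)$ be a finite Coxeter system with length function $\ell$; write $D(w)=\{s\in S:\ell(ws)<\ell(w)\}$ for $w\in W$. For $I\subseteq S$ let $W_I=\langle I\rangle$, $W^I=\{w\in W: D(w)\cap I=\emptyset\}$ and ${}^IW=\{w\in W: D(w^{-1})\cap I=\emptyset\}$. Then $(W_I,I)$ is a finite Coxeter system, and each $w\in W$ has unique factorizations $w=w_I\cdot{}^Iw$ with $w_I\in W_I$, ${}^Iw\in{}^IW$, and $w=w^I\cdot{}_Iw$ with $w^I\in W^I$, ${}_Iw\in W_I$. Identify a subset of $W$ with the sum of its elements in $\mathbb ZW$, and define linear maps $$\mu_I^S,\ \bar\mu_I^S:\mathbb ZW_I\to\mathbb ZW,\quad \mu_I^S(u)=W^I\cdot u,\quad \bar\mu_I^S(u)=u\cdot{}^IW,$$ $$\rho_I^S,\ \bar\rho_I^S:\mathbb ZW\to\mathbb ZW_I,\quad \rho_I^S(w)=w_I,\quad \bar\rho_I^S(w)={}_Iw .$$ Let $(\ )^{-1}:\mathbb ZW\to\mathbb ZW$ be the linear map with $w\mapsto w^{-1}$. Let $\Sigma(W)\subseteq\mathbb ZW$ be the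 $\mathbb Z$-span of the sums $D_J(W)=\sum_{D(w)=J}w$, $J\subseteq S$ (the descent algebra), let $\imath:\Sigma(W)\hookrightarrow\mathbb ZW$ be the inclusion, let $\Sigma^*(W)=\operatorname{Hom}_{\mathbb Z}(\Sigma(W),\mathbb Z)$, and let $\chi:\mathbb ZW\to\Sigma^*(W)$ be the linear map for which $\chi(w)$ sends $D_J(W)$ to $1$ if $J=D(w)$ and to $0$ otherwise. Put $\chi'=\chi\circ(\ )^{-1}$. (1) The maps $\mu_I^S,\rho_I^S$ restrict to maps $\mu_I^S:\Sigma(W_I)\to\Sigma(W)$ and $\rho_I^S:\Sigma(W)\to\Sigma(W_I)$, the maps $\bar\mu_I^S,\bar\rho_I^S$ descend along $\chi$ to maps $\bar\mu_I^S:\Sigma^*(W_I)\to\Sigma^*(W)$ and $\bar\rho_I^S:\Sigma^*(W)\to\Sigma^*(W_I)$, and the following diagram commutes: $$\begin{array}{ccccccc} \Sigma(W_I)&\overset{\imath}{\hookrightarrow}&\mathbb ZW_I&\overset{(\ )^{-1}}{\longleftrightarrow}&\mathbb ZW_I&\overset{\chi}{\twoheadrightarrow}&\Sigma^*(W_I)\\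 {\scriptstyle\mu_I^S}\downarrow&&{\scriptstyle\mu_I^S}\downarrow&&{\scriptstyle\bar\mu_I^S}\downarrow&&{\scriptstyle\bar\mu_I^S}\downarrow\\ \Sigma(W)&\overset{\imath}{\hookrightarrow}&\mathbb ZW&\overset{(\ )^{-1}}{\longleftrightarrow}&\mathbb ZW&\overset{\chi}{\twoheadrightarrow}&\Sigma^*(W)\\ {\scriptstyle\rho_I^S}\downarrow&&{\scriptstyle\rho_I^S}\downarrow&&{\scriptstyle\bar\rho_I^S}\downarrow&&{\scriptstyle\bar\rho_I^S}\downarrow\\ \Sigma(W_I)&\overset{\imath}{\hookrightarrow}&\mathbb ZW_I&\overset{(\ )^{-1}}{\longleftrightarrow}&\mathbb ZW_I&\overset{\chi}{\twoheadrightarrow}&\Sigma^*(W_I) \end{array}$$ Here $\imath$ is injective, $(\ )^{-1}$ bijective and $\chi$ surjective. (2) Rotating the diagram by $180^\circ$ gives a dual diagram: with respect to the perfect pairings $\langle u,v\rangle=\delta_{u,v}$ on $\mathbb ZW$ and evaluation on $\Sigma(W)\times\Sigma^*(W)$, the map $\mu_I^S$ is dual to $\bar\rho_I^S$ and $\rho_I^S$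 is dual to $\bar\mu_I^S$ (both on the group algebras and between $\Sigma$ and $\Sigma^*$), $\imath$ is dual to $\chi$, and $(\ )^{-1}$ is self-dual. (3) Let $\mathcal Cox$ be the category of finite Coxeter systems whose morphisms are the embeddings $f:(W',S')\hookrightarrow(W,S)$, i.e. the injective group homomorphisms with $f(S')\subseteq S$; $f$ identifies $(W',S')$ with $(W_I,I)$, $I=f(S')$, and so gives maps as above with $W'$ in place of $W_I$. All of (1) and (2) holds for these maps. Sending $f$ to $\mu_I^S$ gives functors $\Sigma$ and $\Omega:(W,S)\mapsto\mathbb ZW$ from $\mathcal Cox$ to $\mathbb Z$-modules, and sending $f$ to $\bar\mu_I^S$ gives functors $\Omega^*:(W,S)\mapsto\mathbb ZW$ and $\Sigma^*$ from $\mathcal Cox$ to $\mathbb Z$-modules; likewise $\rho_I^S$ (for $\Sigma,\Omega$) and $\bar\rho_I^S$ (for $\Omega^*,\Sigma^*$) give functors from $\mathcal Cox^{op}$ to $\mathbb Z$-modules. On both categories, $\imath:\Sigma\to\Omega$, $\chi:\Omega^*\to\Sigma^*$ and $\chi':\Omega\to\Sigma^*$ are natural transformations. -/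

import Mathlib

open CategoryTheory MonoidAlgebra

universe u v w

/-! ### Finite Coxeter systems and their category -/

/-- A finite Coxeter system `(W, S)`: a finite group `W` with a Coxeter presentation.  The simple
generators are indexed by `B`, that is `S = {cs.simple i : i ∈ B}`, and subsets of `S` are given as
subsets of `B`. -/
structure Cox : Type (u + 1) where
  /-- the index set of the simple generators -/
  B : Type u
  /-- the group -/
  W : Type u
  [group : Group W]
  [finite : Finite W]
  /-- the Coxeter matrix `(m_{st})` -/
  M : CoxeterMatrix B
  /-- the Coxeter presentation -/
  cs : CoxeterSystem M W

namespace Cox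

attribute [instance] Cox.group Cox.finite

/-- An embedding `(W', S') ↪ (W, S)` of Coxeter systems: an injective group homomorphism that maps
`S'` into `S`. -/
@[ext]
structure Emb (X Y : Cox.{u}) where
  /-- the underlying group homomorphism -/
  hom : X.W →* Y.W
  injective : Function.Injective hom
  map_simple : ∀ i : X.B, ∃ j : Y.B, hom (X.cs.simple i) = Y.cs.simple j

/-- The category of finite Coxeter systems and their embeddings. -/
instance : Category Cox.{u} where
  Hom X Y := Emb X Y
  id X := ⟨MonoidHom.id X.W, fun _ _ h => h, fun i => ⟨i, rfl⟩⟩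
  comp f g :=
    { hom := g.hom.comp f.hom
      injective := g.injective.comp f.injective
      map_simple := fun i => by
        obtain ⟨j, hj⟩ := f.map_simple i
        obtain ⟨k, hk⟩ := g.map_simple j
        exact ⟨k, by rw [MonoidHom.comp_apply, hj, hk]⟩ }

/-- The group homomorphism underlying a morphism. -/
def homOf {X Y : Cox.{u}} (f : X ⟶ Y) : X.W →* Y.W := Emb.hom f

/-- The subset `I ⊆ S` that is the image of `S'` under an embedding `f : (W', S') ↪ (W, S)`; `f`
identifies `(W', S')` with `(W_I, I)`. -/
def support {X Y : Cox.{u}} (f : X ⟶ Y) : Set Y.B :=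
  {j | ∃ i : X.B, homOf f (X.cs.simple i) = Y.cs.simple j}

/-- The parabolic subgroup `W_I`, generated by `I`. -/
def parabolic (X : Cox.{u}) (I : Set X.B) : Subgroup X.W :=
  Subgroup.closure (X.cs.simple '' I)

/-- The restriction of a Coxeter matrix to a subset `I` of its index set. -/
def restrictMatrix {B : Type u} (M : CoxeterMatrix B) (I : Set B) : CoxeterMatrix I where
  M := fun i j => M i j
  isSymm := by ext i j; exact M.symmetric j i
  diagonal := fun i => M.diagonal i
  off_diagonal := fun i j h => M.off_diagonal i j fun e => h (Subtype.ext e)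

/-- The Coxeter system with underlying group `W_I`, generators indexed by `I` and Coxeter matrix
the restriction of that of `(W, S)`, for a given such presentation `c` of `W_I`. -/
def subsystem (X : Cox.{u}) (I : Set X.B)
    (c : CoxeterSystem (restrictMatrix X.M I) (X.parabolic I)) : Cox.{u} where
  B := I
  W := X.parabolic I
  M := restrictMatrix X.M I
  cs := c

/-! ### Descents and coset representatives -/

/-- The descent set `D(w) = {s ∈ S : ℓ(ws) < ℓ(w)}`. -/
def descents (X : Cox.{u}) (w : X.W) : Set X.B := {i | X.cs.IsRightDescent w i}

/-- `W^I = {w ∈ W : D(w) ⊆ S \ I}`: the minimal length representatives of the left cosets `w W_I`. -/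
def leftReps (X : Cox.{u}) (I : Set X.B) : Set X.W := {w | X.descents w ⊆ Iᶜ}

/-- `^I W = {w ∈ W : D(w⁻¹) ⊆ S \ I}`: the minimal length representatives of the right cosets
`W_I w`. -/
def rightReps (X : Cox.{u}) (I : Set X.B) : Set X.W := {w | X.descents w⁻¹ ⊆ Iᶜ}

/-- Existence of the factorization `w = w_I · ^I w`. -/
theorem exists_rightFactor {X Y : Cox.{u}} (f : X ⟶ Y) (w : Y.W) :
    ∃ u : X.W, ∃ z ∈ Y.rightReps (support f), w = homOf f u * z := by
  obtain ⟨u, hu⟩ := Finite.exists_min fun u : X.W => Y.cs.length ((homOf f u)⁻¹ * w)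
  refine ⟨u, (homOf f u)⁻¹ * w, ?_, by simp⟩
  rintro j hj ⟨i, hi⟩
  have h1 : Y.cs.IsLeftDescent ((homOf f u)⁻¹ * w) j := Y.cs.isRightDescent_inv_iff.1 hj
  have h2 := hu (u * (X.cs.simple i)⁻¹)
  rw [map_mul, map_inv, hi, mul_inv_rev, inv_inv, mul_assoc] at h2
  exact absurd h1 (not_lt.2 h2)

/-- Existence of the factorization `w = w^I · _I w`. -/
theorem exists_leftFactor {X Y : Cox.{u}} (f : X ⟶ Y) (w : Y.W) :
    ∃ u : X.W, ∃ z ∈ Y.leftReps (support f), w = z * homOf f u := by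
  obtain ⟨u, z, hz, h⟩ := exists_rightFactor f w⁻¹
  exact ⟨u⁻¹, z⁻¹, hz, by rw [map_inv, ← mul_inv_rev, ← h, inv_inv]⟩

/-- `w_I`, as an element of `W' ≅ W_I`: the factor in the factorization `w = w_I · ^I w` with
`w_I ∈ W_I` and `^I w ∈ ^I W`. -/
noncomputable def rightFactor {X Y : Cox.{u}} (f : X ⟶ Y) (w : Y.W) : X.W :=
  (exists_rightFactor f w).choose

/-- `_I w`, as an element of `W' ≅ W_I`: the factor in the factorization `w = w^I · _I w` with
`w^I ∈ W^I` and `_I w ∈ W_I`. -/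
noncomputable def leftFactor {X Y : Cox.{u}} (f : X ⟶ Y) (w : Y.W) : X.W :=
  (exists_leftFactor f w).choose

/-! ### The group algebra `ℤW` and the four linear maps -/

/-- The sum in `ℤW` of the elements of a subset of `W`. -/
noncomputable def setSum (X : Cox.{u}) (A : Set X.W) : MonoidAlgebra ℤ X.W :=
  ∑ w ∈ A.toFinite.toFinset, single w 1

/-- `μ_I^S : ℤW_I → ℤW`, `u ↦ W^I · u`. -/
noncomputable def mu {X Y : Cox.{u}} (f : X ⟶ Y) :
    MonoidAlgebra ℤ X.W →ₗ[ℤ] MonoidAlgebra ℤ Y.W :=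
  LinearMap.mulLeft ℤ (Y.setSum (Y.leftReps (support f))) ∘ₗ mapDomainLinearMap ℤ ℤ (homOf f)

/-- `ρ_I^S : ℤW → ℤW_I`, `w ↦ w_I`. -/
noncomputable def rho {X Y : Cox.{u}} (f : X ⟶ Y) :
    MonoidAlgebra ℤ Y.W →ₗ[ℤ] MonoidAlgebra ℤ X.W :=
  mapDomainLinearMap ℤ ℤ (rightFactor f)

/-- `μ̄_I^S : ℤW_I → ℤW`, `u ↦ u · ^I W`. -/
noncomputable def muBar {X Y : Cox.{u}} (f : X ⟶ Y) :
    MonoidAlgebra ℤ X.W →ₗ[ℤ] MonoidAlgebra ℤ Y.W :=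
  LinearMap.mulRight ℤ (Y.setSum (Y.rightReps (support f))) ∘ₗ mapDomainLinearMap ℤ ℤ (homOf f)

/-- `ρ̄_I^S : ℤW → ℤW_I`, `w ↦ _I w`. -/
noncomputable def rhoBar {X Y : Cox.{u}} (f : X ⟶ Y) :
    MonoidAlgebra ℤ Y.W →ₗ[ℤ] MonoidAlgebra ℤ X.W :=
  mapDomainLinearMap ℤ ℤ (leftFactor f)

/-- The linear map `( )⁻¹ : ℤW → ℤW`, `w ↦ w⁻¹`. -/
noncomputable def invMap (X : Cox.{u}) : MonoidAlgebra ℤ X.W →ₗ[ℤ] MonoidAlgebra ℤ X.W :=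
  mapDomainLinearMap ℤ ℤ fun w => w⁻¹

/-- The bilinear form on `ℤW` with `⟨u, v⟩ = δ_{u,v}` for `u, v ∈ W`. -/
noncomputable def form (X : Cox.{u}) :
    MonoidAlgebra ℤ X.W →ₗ[ℤ] MonoidAlgebra ℤ X.W →ₗ[ℤ] ℤ :=
  LinearMap.mk₂ ℤ (fun x y => ∑ᶠ w : X.W, x.coeff w * y.coeff w)
    (fun x x' y => by
      rw [← finsum_add_distrib (Set.toFinite _) (Set.toFinite _)]
      simp [add_mul])
    (fun a x y => by
      rw [smul_eq_mul, mul_finsum]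
      simp only [coeff_smul, Finsupp.smul_apply, smul_eq_mul, mul_assoc])
    (fun x y y' => by
      rw [← finsum_add_distrib (Set.toFinite _) (Set.toFinite _)]
      simp [mul_add])
    (fun a x y => by
      rw [smul_eq_mul, mul_finsum]
      simp only [coeff_smul, Finsupp.smul_apply, smul_eq_mul, mul_left_comm])

/-! ### The descent algebra, its dual, and the maps `ι` and `χ` -/

/-- The descent class sum `D_I(W) = ∑_{D(w) = I} w`. -/
noncomputable def descentSum (X : Cox.{u}) (I : Set X.B) : MonoidAlgebra ℤ X.W :=
  X.setSum {w | X.descents w = I}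

/-- The descent algebra `Σ(W)`, the `ℤ`-span of `{D_I(W) : I ⊆ S}` (only its module structure is
used). -/
noncomputable def descentAlg (X : Cox.{u}) : Submodule ℤ (MonoidAlgebra ℤ X.W) :=
  Submodule.span ℤ (Set.range X.descentSum)

/-- The dual `Σ^*(W)` of the `ℤ`-module `Σ(W)`. -/
abbrev dualDescent (X : Cox.{u}) : Type u := Module.Dual ℤ X.descentAlg

/-- The inclusion `ι : Σ(W) → ℤW`. -/
noncomputable def iota (X : Cox.{u}) : X.descentAlg →ₗ[ℤ] MonoidAlgebra ℤ X.W :=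
  X.descentAlg.subtype

/-- `χ : ℤW → Σ^*(W)`, `w ↦ D^*_w(W)`, where `D^*_w(W) = D^*_{D(w)}(W)` is the functional that reads
off the coefficient of `D_{D(w)}(W)`, that is, the coefficient of `w` (see `chi_single`). -/
noncomputable def chi (X : Cox.{u}) : MonoidAlgebra ℤ X.W →ₗ[ℤ] X.dualDescent :=
  (X.iota.dualMap : Module.Dual ℤ (MonoidAlgebra ℤ X.W) →ₗ[ℤ] X.dualDescent) ∘ₗ X.form.flip

/-- `χ' = χ ∘ ( )⁻¹ : ℤW → Σ^*(W)`. -/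
noncomputable def chi' (X : Cox.{u}) : MonoidAlgebra ℤ X.W →ₗ[ℤ] X.dualDescent :=
  X.chi ∘ₗ X.invMap

/-- The evaluation pairing `Σ(W) × Σ^*(W) → ℤ`. -/
noncomputable def evalPairing (X : Cox.{u}) : X.descentAlg →ₗ[ℤ] X.dualDescent →ₗ[ℤ] ℤ :=
  Module.Dual.eval ℤ X.descentAlg

open Classical in
theorem form_single (X : Cox.{u}) (u w : X.W) :
    X.form (single u 1) (single w 1) = if u = w then 1 else 0 := by
  rw [form, LinearMap.mk₂_apply, finsum_eq_single _ u]
  · simp [Finsupp.single_apply, eq_comm]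
  · intro v hv
    simp [Finsupp.single_apply, hv.symm]

theorem descentSum_mem (X : Cox.{u}) (I : Set X.B) : X.descentSum I ∈ X.descentAlg :=
  Submodule.subset_span ⟨I, rfl⟩

open Classical in
/-- `⟨D_I(W), D^*_w(W)⟩ = δ_{I, D(w)}`. -/
theorem chi_single (X : Cox.{u}) (w : X.W) (I : Set X.B) :
    X.chi (single w 1) ⟨X.descentSum I, X.descentSum_mem I⟩ =
      if X.descents w = I then 1 else 0 := by
  change X.form (X.descentSum I) (single w 1) = _
  simp only [descentSum, setSum, map_sum, LinearMap.sum_apply, form_single]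
  simp

end Cox

/-! ### Duality of maps and representations of categories -/

/-- With respect to the pairings `p : A × A' → ℤ` and `q : C × C' → ℤ`, the maps `f : A → C` and
`g : C' → A'` are dual to each other: `⟨f a, c'⟩ = ⟨a, g c'⟩`. -/
def DualMaps {A A' C C' : Type*} [AddCommGroup A] [AddCommGroup A'] [AddCommGroup C]
    [AddCommGroup C'] [Module ℤ A] [Module ℤ A'] [Module ℤ C] [Module ℤ C']
    (p : A →ₗ[ℤ] A' →ₗ[ℤ] ℤ) (q : C →ₗ[ℤ] C' →ₗ[ℤ] ℤ)
    (f : A →ₗ[ℤ] C) (g : C' →ₗ[ℤ] A') : Prop :=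
  ∀ (a : A) (c' : C'), q (f a) c' = p a (g c')

/-- Functoriality of an assignment of `ℤ`-modules to objects and linear maps to morphisms. -/
structure IsRep {C : Type v} [Category.{w} C] (obj : C → Type u) [∀ X, AddCommGroup (obj X)]
    [∀ X, Module ℤ (obj X)]
    (map : ∀ {X Y : C}, (X ⟶ Y) → (obj X →ₗ[ℤ] obj Y)) : Prop where
  map_id : ∀ X : C, map (𝟙 X) = LinearMap.id
  map_comp : ∀ {X Y Z : C} (f : X ⟶ Y) (g : Y ⟶ Z), map (f ≫ g) = map g ∘ₗ map f

/-- The representation (covariant functor to `ℤ`-modules) given by a functorial assignment. -/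
def IsRep.functor {C : Type v} [Category.{w} C] {obj : C → Type u} [∀ X, AddCommGroup (obj X)]
    [∀ X, Module ℤ (obj X)]
    {map : ∀ {X Y : C}, (X ⟶ Y) → (obj X →ₗ[ℤ] obj Y)} (h : IsRep obj map) :
    C ⥤ ModuleCat.{u} ℤ where
  obj X := ModuleCat.of ℤ (obj X)
  map f := ModuleCat.ofHom (map f)
  map_id X := by rw [h.map_id]; rfl
  map_comp f g := by rw [h.map_comp]; rfl

namespace CoxeterSystem

open List

variable {B W : Type*} [Group W] {M : CoxeterMatrix B} (cs : CoxeterSystem M W)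

/-! ### The parity of inversions and the strong exchange property -/

/-! Everything is read off from length additivity: `z` lies in `W^I` exactly when ℓ(zu) = ℓ(z) +
ℓ(u) for all `u ∈ W_I` (`mem_leftReps_iff`). This gives uniqueness of the factorizations and their
transitivity along compositions.

For the form δ the coefficient of `w` in `W^I · u` is 1 or 0 according to whether `u` is the factor
`_I w`, so μ is adjoint to ρ̄, and likewise μ̄ to ρ. Inversion exchanges the two sides.
Functoriality is therefore checked only for ρ and ρ̄, where it is transitivity of the factors, and
transported to μ and μ̄ by nondegeneracy.

An element lies in Σ(W) exactly when its coefficients are constant on descent classes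
(`mem_descentAlg_iff`). By adjunction μ preserves Σ because D(`_I w`) = D(w) ∩ I, and ρ preserves Σ
because, for `z ∈ ^I W`, the set D(uz) depends only on `z` and D(u) (`descents_homOf_mul_congr`).
The maps on Σ^* are the transposes of these restrictions, and the squares with χ restate the
adjunctions.

The Coxeter-theoretic input is proved from the presentation: strong exchange, through an action on
pairs of a group element and a parity; the exact order of s_i s_j, through a reflection
representation; and the presentation of `W_I`, through a comparison of reduced words by braid
relations. -/

theorem simple_mul_pow_mul_simple (i j : B) (n : ℕ) :
    ((cs.simple i * cs.simple j) ^ n)⁻¹ * cs.simple j =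
      cs.simple j * (cs.simple i * cs.simple j) ^ n := by
  induction n with
  | zero => simp
  | succ n ih =>
    rw [pow_succ', mul_inv_rev, mul_assoc, show (cs.simple i * cs.simple j)⁻¹ * cs.simple j =
      cs.simple j * (cs.simple i * cs.simple j) by simp [mul_assoc], ← mul_assoc, ih, mul_assoc, ← pow_succ,
      ← pow_succ']

/-- The entries are `M i j`-periodic in `k`, so a word of length `2 * M i j` lists each of them an
even number of times. This is the relation needed for `parityStep`. -/
theorem rightInvSeq_alternatingWord (i j : B) (n : ℕ) :
    cs.rightInvSeq (alternatingWord i j n) =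
      ((List.range n).map fun k => cs.simple j * (cs.simple i * cs.simple j) ^ k).reverse := by
  induction n with
  | zero => simp [alternatingWord]
  | succ n ih =>
    rw [alternatingWord_succ', rightInvSeq, ih, List.range_succ, List.map_append,
      List.reverse_append, cs.prod_alternatingWord_eq_mul_pow]
    simp only [map_cons, map_nil, reverse_cons, reverse_nil, nil_append, cons_append, cons.injEq,
      and_true]
    obtain ⟨h, rfl | rfl⟩ := Nat.even_or_odd' n
    · simp only [even_two, Even.mul_right, ↓reduceIte, one_mul,
        mul_div_cancel_left₀, ne_eq, OfNat.ofNat_ne_zero, not_false_eq_true]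
      rw [cs.simple_mul_pow_mul_simple, mul_assoc, ← pow_add, two_mul]
    · have h1 : ¬ Even (2 * h + 1) := by simp
      have h2 : (2 * h + 1) / 2 = h := by omega
      rw [if_neg h1, if_neg h1, h2, mul_inv_rev, inv_simple, cs.simple_mul_pow_mul_simple,
        show 2 * h + 1 = h + (1 + h) by ring, pow_add, pow_add, pow_one]
      simp only [mul_assoc]

open Classical in
/-- The action of a simple generator on pairs of a group element and a parity. -/
noncomputable def parityStep (i : B) : Function.End (W × ZMod 2) := fun p =>
  (cs.simple i * p.1 * cs.simple i, p.2 + if p.1 = cs.simple i then 1 else 0)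

-- A letter flips the parity when the element, conjugated by the letters to its right, equals that
-- letter. Conjugated back, this says that the original element is the corresponding entry of the
-- right inversion sequence.
open Classical in
theorem prod_map_parityStep (ω : List B) (p : W × ZMod 2) :
    (ω.map cs.parityStep).prod p =
      (cs.wordProd ω * p.1 * (cs.wordProd ω)⁻¹, p.2 + ((cs.rightInvSeq ω).count p.1 : ZMod 2)) := by
  induction ω with
  | nil => simp; rfl
  | cons i ω ih =>
    rw [List.map_cons, List.prod_cons]
    change cs.parityStep i ((ω.map cs.parityStep).prod p) = _
    rw [ih, parityStep, rightInvSeq, List.count_cons, wordProd_cons]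
    have h : (cs.wordProd ω * p.1 * (cs.wordProd ω)⁻¹ = cs.simple i) ↔
        ((cs.wordProd ω)⁻¹ * cs.simple i * cs.wordProd ω = p.1) :=
      ⟨fun h => by rw [← h]; group, fun h => by rw [← h]; group⟩
    simp only [beq_iff_eq, ← h]
    simp only [Prod.mk.injEq, mul_inv_rev, inv_simple, mul_assoc, true_and]
    push_cast
    rw [add_assoc]

theorem map_alternatingWord_prod {G : Type*} [Monoid G] (f : B → G) (i j : B) (n : ℕ) :
    ((alternatingWord i j (2 * n)).map f).prod = (f i * f j) ^ n := by
  induction n with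
  | zero => simp [alternatingWord]
  | succ n ih =>
    rw [show 2 * (n + 1) = 2 * n + 1 + 1 by ring, alternatingWord_succ', alternatingWord_succ']
    simp [ih, pow_succ', mul_assoc]

theorem isLiftable_parityStep : M.IsLiftable cs.parityStep := by
  classical
  intro i j
  rw [← map_alternatingWord_prod]
  funext p
  rw [prod_map_parityStep, prod_alternatingWord_eq_mul_pow]
  simp only [even_two, Even.mul_right, ↓reduceIte, one_mul, mul_div_cancel_left₀,
    ne_eq, OfNat.ofNat_ne_zero, not_false_eq_true, simple_mul_simple_pow, inv_one, mul_one]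
  have : ((cs.rightInvSeq (alternatingWord i j (2 * M i j))).count p.1 : ZMod 2) = 0 := by
    rw [rightInvSeq_alternatingWord, List.count_reverse, two_mul, List.range_add, List.map_append,
      List.map_map, List.count_append]
    have : ((fun k => cs.simple j * (cs.simple i * cs.simple j) ^ k) ∘ fun x => M i j + x) =
        fun k => cs.simple j * (cs.simple i * cs.simple j) ^ k := by
      funext k
      simp [pow_add]
    rw [this]
    push_cast
    exact CharTwo.add_self_eq_zero _
  rw [this]
  simp
  rfl

/-- The parity of the number of occurrences of `t` in an inversion sequence of `w`. -/
noncomputable def invParity (w t : W) : ZMod 2 :=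
  (cs.lift ⟨cs.parityStep, cs.isLiftable_parityStep⟩ w (t, 0)).2

open Classical in
theorem invParity_wordProd (ω : List B) (t : W) :
    cs.invParity (cs.wordProd ω) t = (cs.rightInvSeq ω).count t := by
  rw [invParity, wordProd, map_list_prod, List.map_map]
  have : (cs.lift ⟨cs.parityStep, cs.isLiftable_parityStep⟩ : W → _) ∘ cs.simple =
      cs.parityStep := by
    funext i
    exact cs.lift_apply_simple cs.isLiftable_parityStep i
  rw [this, prod_map_parityStep]
  simp

/-- The inversion sequence of a concatenation is that of the right word preceded by conjugates of
that of the left word, which makes the parity a cocycle. -/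
theorem invParity_mul (w v t : W) :
    cs.invParity (w * v) t = cs.invParity v t + cs.invParity w (v * t * v⁻¹) := by
  classical
  obtain ⟨ω, rfl⟩ := cs.wordProd_surjective w
  obtain ⟨ψ, rfl⟩ := cs.wordProd_surjective v
  rw [← wordProd_append, invParity_wordProd, invParity_wordProd, invParity_wordProd]
  induction ω with
  | nil => simp
  | cons i ω ih =>
    simp only [cons_append, rightInvSeq, List.count_cons, Nat.cast_add, ih, wordProd_append,
      add_assoc]
    congr 3
    refine if_congr ?_ rfl rfl
    simp only [beq_iff_eq, mul_inv_rev]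
    refine ⟨fun h => by rw [← h]; group, fun h => ?_⟩
    calc _ = (cs.wordProd ψ)⁻¹ * ((cs.wordProd ω)⁻¹ * cs.simple i * cs.wordProd ω) *
          cs.wordProd ψ := by group
      _ = t := by rw [h]; group

theorem invParity_simple_self (i : B) : cs.invParity (cs.simple i) (cs.simple i) = 1 := by
  classical
  have := cs.invParity_wordProd [i] (cs.simple i)
  rw [wordProd_singleton] at this
  simp [this]

theorem invParity_one (t : W) : cs.invParity 1 t = 0 := by
  classical
  have := cs.invParity_wordProd [] t
  simpa using this

/-- In `w s w⁻¹` the contributions of `w` and `w⁻¹` cancel, by the cocycle identity for `w w⁻¹ = 1`;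
only that of `s` remains. -/
theorem IsReflection.invParity_self {t : W} (ht : cs.IsReflection t) : cs.invParity t t = 1 := by
  obtain ⟨w, i, rfl⟩ := ht
  have h0 := cs.invParity_mul w w⁻¹ (w * cs.simple i * w⁻¹)
  rw [mul_inv_cancel, invParity_one] at h0
  rw [invParity_mul, invParity_mul]
  have e1 : w⁻¹ * (w * cs.simple i * w⁻¹) * w⁻¹⁻¹ = cs.simple i := by group
  rw [e1] at h0 ⊢
  simp only [simple_mul_simple_self, one_mul, inv_simple, invParity_simple_self]
  rw [add_left_comm, ← h0, add_zero]

/-- The strong exchange property. -/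
theorem mem_rightInvSeq_of_isRightInversion (ω : List B) {t : W}
    (h : cs.IsRightInversion (cs.wordProd ω) t) : t ∈ cs.rightInvSeq ω := by
  classical
  -- If `t` were missing, its parity for `wt` would be odd, so `t` would be an inversion of `wt` as
  -- well as of `w`.
  by_contra hmem
  have h0 : cs.invParity (cs.wordProd ω) t = 0 := by
    rw [invParity_wordProd, List.count_eq_zero_of_not_mem hmem, Nat.cast_zero]
  have h1 : cs.invParity (cs.wordProd ω * t) t = 1 := by
    rw [invParity_mul, h.1.invParity_self, mul_inv_cancel_right, h0, add_zero]
  obtain ⟨ψ, hψ, e⟩ := cs.exists_isReduced (cs.wordProd ω * t)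
  rw [e, invParity_wordProd] at h1
  have h2 : t ∈ cs.rightInvSeq ψ := by
    by_contra h3
    rw [List.count_eq_zero_of_not_mem h3] at h1
    simp at h1
  have h3 := (cs.isRightInversion_of_mem_rightInvSeq hψ h2).2
  rw [← e, mul_assoc, h.1.mul_self, mul_one] at h3
  exact lt_asymm h3 h.2

/-- A right descent of the product of a word may be exchanged for one of its letters. -/
theorem exists_eraseIdx_of_isRightInversion (ω : List B) {t : W}
    (h : cs.IsRightInversion (cs.wordProd ω) t) :
    ∃ k < ω.length, cs.wordProd ω * t = cs.wordProd (ω.eraseIdx k) := by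
  obtain ⟨k, hk, e⟩ := List.mem_iff_getElem.1 (cs.mem_rightInvSeq_of_isRightInversion ω h)
  refine ⟨k, by simpa using hk, ?_⟩
  rw [← wordProd_mul_getD_rightInvSeq, List.getD_eq_getElem _ 1 hk, e]

end CoxeterSystem

namespace CoxeterMatrix

variable {B : Type*} (M : CoxeterMatrix B)

/-! ### The contragredient geometric representation and the order of `s_i s_j` -/

/-- The angle `π / M i j`, where an infinite entry is replaced by `N`. -/
noncomputable def angle (N : ℕ) (i j : B) : ℝ :=
  Real.pi / (if M i j = 0 then N else M i j : ℕ)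

theorem angle_comm (N : ℕ) (i j : B) : M.angle N i j = M.angle N j i := by
  rw [angle, angle, M.symmetric]

/-- The action of a simple reflection on functions on the set of simple roots. -/
noncomputable def reflect (N : ℕ) (i : B) : Module.End ℝ (B → ℝ) where
  toFun f k := f k + 2 * Real.cos (M.angle N i k) * f i
  map_add' f g := by ext k; simp; ring
  map_smul' a f := by ext k; simp; ring

theorem reflect_apply (N : ℕ) (i k : B) (f : B → ℝ) :
    M.reflect N i f k = f k + 2 * Real.cos (M.angle N i k) * f i := rfl

theorem cos_angle_self (N : ℕ) (i : B) : Real.cos (M.angle N i i) = -1 := by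
  simp [angle]

theorem sin_angle_ne_zero {N : ℕ} (hN : 2 ≤ N) {i j : B} (h : i ≠ j) :
    Real.sin (M.angle N i j) ≠ 0 := by
  have h2 : 2 ≤ (if M i j = 0 then N else M i j : ℕ) := by
    have := M.off_diagonal i j h
    split_ifs <;> grind
  rw [angle]
  generalize (if M i j = 0 then N else M i j : ℕ) = m at h2
  have h3 : (2 : ℝ) ≤ m := by exact_mod_cast h2
  refine (Real.sin_pos_of_pos_of_lt_pi (by positivity) ?_).ne'
  rw [div_lt_iff₀ (by linarith)]
  nlinarith [Real.pi_pos]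

/-- On the coordinates `i`, `j` the product is, in oblique coordinates, a rotation through twice the
angle; the sine factor clears denominators. -/
theorem reflect_mul_pow_apply (N : ℕ) (i j : B) (f : B → ℝ) (k : ℕ) :
    Real.sin (M.angle N i j) * ((M.reflect N i * M.reflect N j) ^ k) f i =
        f i * Real.sin (M.angle N i j - 2 * k * M.angle N i j) -
          f j * Real.sin (2 * k * M.angle N i j) ∧
      Real.sin (M.angle N i j) * ((M.reflect N i * M.reflect N j) ^ k) f j =
        f i * Real.sin (2 * k * M.angle N i j) +
          f j * Real.sin (M.angle N i j + 2 * k * M.angle N i j) := by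
  induction k with
  | zero => simp; constructor <;> ring
  | succ k ih =>
    obtain ⟨h1, h2⟩ := ih
    rw [pow_succ', Module.End.mul_apply, Module.End.mul_apply]
    generalize ((M.reflect N i * M.reflect N j) ^ k) f = g at h1 h2
    simp only [reflect_apply, M.angle_comm N j i, cos_angle_self]
    push_cast
    set a := M.angle N i j
    rw [show 2 * ((k : ℝ) + 1) * a = a + a + 2 * k * a by ring]
    generalize 2 * (k : ℝ) * a = b at *
    rw [show a - (a + a + b) = - (a + b) by ring, show a + (a + a + b) = a + (a + (a + b)) by ring,
      show a + a + b = a + (a + b) by ring, Real.sin_neg]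
    simp only [Real.sin_add, Real.sin_sub, Real.cos_add] at *
    have h3 := Real.sin_sq_add_cos_sq a
    constructor
    · linear_combination -h1 - 2 * Real.cos a * h2 - Real.sin b * f j * h3
    · linear_combination 2 * Real.cos a * h1 + (4 * Real.cos a ^ 2 - 1) * h2 +
        (Real.sin a * Real.cos b * f j + 3 * Real.cos a * Real.sin b * f j + f i * Real.sin b) * h3

theorem isLiftable_reflect {N : ℕ} (hN : 2 ≤ N) : M.IsLiftable (M.reflect N) := by
  intro i j
  obtain rfl | hij := eq_or_ne i j
  · rw [M.diagonal, pow_one]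
    ext1 f
    funext k
    simp only [Module.End.mul_apply, reflect_apply, cos_angle_self, Module.End.one_apply]
    ring
  obtain h0 | h0 := eq_or_ne (M i j) 0
  · rw [h0, pow_zero]
  ext1 f
  have hs := M.sin_angle_ne_zero hN hij
  have hi : ((M.reflect N i * M.reflect N j) ^ M i j) f i = f i := by
    have := (M.reflect_mul_pow_apply N i j f (M i j)).1
    have e : 2 * (M i j : ℝ) * M.angle N i j = 2 * Real.pi := by
      have : (M i j : ℝ) ≠ 0 := by exact_mod_cast h0
      rw [angle, if_neg h0]
      field_simp
    rw [e, Real.sin_sub_two_pi, Real.sin_two_pi] at this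
    exact mul_left_cancel₀ hs (by linarith)
  have hj : ((M.reflect N i * M.reflect N j) ^ M i j) f j = f j := by
    have := (M.reflect_mul_pow_apply N i j f (M i j)).2
    have e : 2 * (M i j : ℝ) * M.angle N i j = 2 * Real.pi := by
      have : (M i j : ℝ) ≠ 0 := by exact_mod_cast h0
      rw [angle, if_neg h0]
      field_simp
    rw [e, Real.sin_add_two_pi, Real.sin_two_pi] at this
    exact mul_left_cancel₀ hs (by linarith)
  funext l
  -- The two equations say that `f l - p * f i - q * f j` is invariant under both reflections. The
  -- system has determinant proportional to the squared sine.
  obtain ⟨p, q, hp, hq⟩ : ∃ p q : ℝ,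
      2 * Real.cos (M.angle N i l) + 2 * p - 2 * Real.cos (M.angle N i j) * q = 0 ∧
      2 * Real.cos (M.angle N j l) + 2 * q - 2 * Real.cos (M.angle N i j) * p = 0 := by
    have h3 := Real.sin_sq_add_cos_sq (M.angle N i j)
    refine ⟨-(Real.cos (M.angle N i l) + Real.cos (M.angle N j l) * Real.cos (M.angle N i j)) /
      Real.sin (M.angle N i j) ^ 2,
      -(Real.cos (M.angle N j l) + Real.cos (M.angle N i l) * Real.cos (M.angle N i j)) /
      Real.sin (M.angle N i j) ^ 2, ?_, ?_⟩
    · field_simp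
      linear_combination 2 * (Real.cos (M.angle N i l)) * h3
    · field_simp
      linear_combination 2 * (Real.cos (M.angle N j l)) * h3
  have inv : ∀ k : ℕ, ((M.reflect N i * M.reflect N j) ^ k) f l -
      p * ((M.reflect N i * M.reflect N j) ^ k) f i -
      q * ((M.reflect N i * M.reflect N j) ^ k) f j = f l - p * f i - q * f j := by
    intro k
    induction k with
    | zero => simp
    | succ k ih =>
      rw [pow_succ', Module.End.mul_apply, Module.End.mul_apply, ← ih]
      generalize ((M.reflect N i * M.reflect N j) ^ k) f = g
      simp only [reflect_apply, M.angle_comm N j i, cos_angle_self]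
      linear_combination (g i + 2 * Real.cos (M.angle N i j) * g j) * hp + g j * hq
  have := inv (M i j)
  rw [hi, hj] at this
  simpa using this

end CoxeterMatrix

namespace CoxeterSystem

variable {B W : Type*} [Group W] {M : CoxeterMatrix B} (cs : CoxeterSystem M W)

/-- The order of `s_i s_j` is `M i j` (and infinite if `M i j = 0`). -/
theorem dvd_of_simple_mul_simple_pow_eq_one {i j : B} {k : ℕ}
    (h : (cs.simple i * cs.simple j) ^ k = 1) : M i j ∣ k := by
  obtain rfl | hij := eq_or_ne i j
  · simp
  -- Infinite entries are replaced by `k + 2`: at least 2, and too large to divide `k` unless `k =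
  -- 0`.
  have hN : 2 ≤ k + 2 := by omega
  have hs := M.sin_angle_ne_zero hN hij
  have h1 := congrArg (cs.lift ⟨_, M.isLiftable_reflect hN⟩) h
  rw [map_pow, map_mul, map_one, lift_apply_simple, lift_apply_simple] at h1
  classical
  obtain ⟨h2, h3⟩ := M.reflect_mul_pow_apply (k + 2) i j (Pi.single j 1) k
  rw [h1] at h2 h3
  simp only [Module.End.one_apply, ne_eq, hij, not_false_eq_true, Pi.single_eq_of_ne, mul_zero,
    zero_mul, Pi.single_eq_same, one_mul, zero_sub, zero_add, mul_one] at h2 h3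
  have h4 : Real.sin (2 * k * M.angle (k + 2) i j) = 0 := by linarith
  rw [Real.sin_add, h4, mul_zero, add_zero] at h3
  have h5 : Real.cos (2 * k * M.angle (k + 2) i j) = 1 := by
    refine mul_left_cancel₀ hs ?_
    rw [← h3, mul_one]
  obtain ⟨n, hn⟩ := (Real.cos_eq_one_iff _).1 h5
  rw [CoxeterMatrix.angle] at hn
  set m : ℕ := (if M i j = 0 then k + 2 else M i j : ℕ) with hm
  have hm0 : m ≠ 0 := by rw [hm]; split_ifs <;> omega
  have hm0' : (m : ℝ) ≠ 0 := by exact_mod_cast hm0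
  have h6 : (n : ℝ) * m = k := by
    field_simp at hn
    exact hn
  have h7 : m ∣ k := by
    have : (m : ℤ) ∣ k := ⟨n, by rw [mul_comm]; exact_mod_cast h6.symm⟩
    exact_mod_cast this
  rw [hm] at h7
  split_ifs at h7 with h0
  · obtain rfl : k = 0 := by
      by_contra hk
      have := Nat.le_of_dvd (Nat.pos_of_ne_zero hk) h7
      omega
    exact dvd_zero _
  · exact h7

theorem simple_injective : Function.Injective cs.simple := by
  intro i j h
  by_contra hij
  have : (cs.simple i * cs.simple j) ^ 1 = 1 := by simp [h]
  exact M.off_diagonal i j hij (Nat.dvd_one.1 (cs.dvd_of_simple_mul_simple_pow_eq_one this))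

end CoxeterSystem

namespace CoxeterSystem

open List

variable {B W : Type*} [Group W] {M : CoxeterMatrix B} (cs : CoxeterSystem M W)

/-! ### Words in a subset of the generators and minimal coset representatives -/

section Words

variable {ι : Type*} (g : ι → B)

theorem isReduced_of_length_le {ω : List B} (h : ω.length ≤ cs.length (cs.wordProd ω)) :
    cs.IsReduced ω :=
  le_antisymm (cs.length_wordProd_le ω) h

theorem isReduced_concat_of_not_isRightDescent {ω : List B} (hω : cs.IsReduced ω) {i : B}
    (h : ¬ cs.IsRightDescent (cs.wordProd ω) i) : cs.IsReduced (ω ++ [i]) := by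
  apply cs.isReduced_of_length_le
  rw [wordProd_append, wordProd_singleton, cs.not_isRightDescent_iff.1 h, hω.eq]
  simp

theorem not_isRightDescent_of_isReduced_concat {ω : List B} {i : B}
    (h : cs.IsReduced (ω ++ [i])) : ¬ cs.IsRightDescent (cs.wordProd ω) i := by
  intro h1
  have h2 := h.eq
  rw [wordProd_append, wordProd_singleton] at h2
  have h3 := cs.length_wordProd_le ω
  rw [IsRightDescent, h2] at h1
  simp at h1
  omega

theorem IsReduced.of_append {ω ψ : List B} (h : cs.IsReduced (ω ++ ψ)) : cs.IsReduced ω := by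
  simpa using h.take ω.length

/-- A right descent of a reduced word in a subset of the generators removes one of its letters. -/
theorem exists_isReduced_map_of_isRightDescent {ω : List ι} (hω : cs.IsReduced (ω.map g)) {i : B}
    (h : cs.IsRightDescent (cs.wordProd (ω.map g)) i) :
    ∃ ψ : List ι, cs.IsReduced (ψ.map g) ∧ ψ.length + 1 = ω.length ∧
      cs.wordProd (ω.map g) * cs.simple i = cs.wordProd (ψ.map g) := by
  obtain ⟨k, hk, e⟩ := cs.exists_eraseIdx_of_isRightInversion (ω.map g)
    ((cs.isRightInversion_simple_iff_isRightDescent _ i).2 h)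
  rw [List.length_map] at hk
  have hl := List.length_eraseIdx_add_one hk
  rw [List.eraseIdx_map] at e
  refine ⟨ω.eraseIdx k, cs.isReduced_of_length_le ?_, hl, e⟩
  have h1 := cs.isRightDescent_iff.1 h
  rw [hω.eq, List.length_map] at h1
  rw [← e, List.length_map]
  omega

/-- Exchange only deletes letters, so a word can be reduced without leaving the given generators. -/
theorem exists_isReduced_map (ω : List ι) :
    ∃ ψ : List ι, cs.IsReduced (ψ.map g) ∧ cs.wordProd (ω.map g) = cs.wordProd (ψ.map g) := by
  induction ω using List.reverseRecOn with
  | nil => exact ⟨[], by simp [IsReduced], rfl⟩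
  | append_singleton ω i ih =>
    obtain ⟨ψ, hψ, e⟩ := ih
    rw [List.map_append, wordProd_append, e, List.map_singleton, wordProd_singleton]
    by_cases h : cs.IsRightDescent (cs.wordProd (ψ.map g)) (g i)
    · obtain ⟨ξ, h1, -, h2⟩ := cs.exists_isReduced_map_of_isRightDescent g hψ h
      exact ⟨ξ, h1, h2⟩
    · refine ⟨ψ ++ [i], ?_, by simp [wordProd_append]⟩
      rw [List.map_append]
      exact cs.isReduced_concat_of_not_isRightDescent hψ h

/-- `z` has minimal length in its left coset modulo the subgroup generated by the `g i`. -/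
def IsMinimalLeft (z : W) : Prop :=
  ∀ ω : List ι, cs.length z ≤ cs.length (z * cs.wordProd (ω.map g))

-- If the last letter were a descent, exchange would delete a letter from a reduced word of `z`,
-- giving a shorter element of the same coset, or from the word in the `g i`, which is reduced.
variable {g} in
theorem IsMinimalLeft.length_mul {z : W} (hz : cs.IsMinimalLeft g z) {ψ : List ι}
    (hψ : cs.IsReduced (ψ.map g)) :
    cs.length (z * cs.wordProd (ψ.map g)) = cs.length z + ψ.length := by
  induction ψ using List.reverseRecOn with
  | nil => simp
  | append_singleton ψ i ih =>
    rw [List.map_append, List.map_singleton] at hψ ⊢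
    have hψ' := IsReduced.of_append cs hψ
    rw [wordProd_append, wordProd_singleton, ← mul_assoc, List.length_append,
      List.length_singleton, ← add_assoc, ← ih hψ', ← cs.not_isRightDescent_iff]
    intro hd
    obtain ⟨ζ, hζ, rfl⟩ := cs.exists_isReduced z
    rw [← wordProd_append] at hd
    obtain ⟨k, hk, e⟩ := cs.exists_eraseIdx_of_isRightInversion (ζ ++ ψ.map g)
      ((cs.isRightInversion_simple_iff_isRightDescent _ _).2 hd)
    obtain hk' | hk' := lt_or_ge k ζ.length
    · rw [List.eraseIdx_append_of_lt_length hk', wordProd_append, wordProd_append] at e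
      -- Conjugating the last letter by `ψ` moves the deletion onto `z` alone.
      have h1 := hz (ψ ++ [i] ++ ψ.reverse)
      rw [List.map_append, List.map_append, List.map_reverse, wordProd_append, wordProd_append,
        wordProd_reverse, List.map_singleton, wordProd_singleton, ← mul_assoc, ← mul_assoc, e,
        mul_inv_cancel_right, hζ.eq] at h1
      have h2 := cs.length_wordProd_le (ζ.eraseIdx k)
      have h3 := List.length_eraseIdx_add_one hk'
      omega
    · rw [List.eraseIdx_append_of_length_le hk', wordProd_append, wordProd_append, mul_assoc] at e
      rw [List.length_append] at hk
      have h1 := hψ.eq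
      rw [wordProd_append, wordProd_singleton, mul_left_cancel e] at h1
      have h2 := cs.length_wordProd_le ((ψ.map g).eraseIdx (k - ζ.length))
      have h3 := List.length_eraseIdx_add_one (l := ψ.map g) (i := k - ζ.length) (by omega)
      rw [List.length_append, List.length_singleton] at h1
      omega

theorem exists_isMinimalLeft (w : W) :
    ∃ (z : W) (ω : List ι), cs.IsMinimalLeft g z ∧ cs.IsReduced (ω.map g) ∧
      w = z * cs.wordProd (ω.map g) := by
  let f : List ι → ℕ := fun ω => cs.length (w * cs.wordProd (ω.map g))
  obtain ⟨ω, -, hω⟩ := WellFounded.has_min (measure f).wf Set.univ ⟨[], trivial⟩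
  obtain ⟨ψ, hψ, e⟩ := cs.exists_isReduced_map g ω.reverse
  refine ⟨w * cs.wordProd (ω.map g), ψ, fun ξ => ?_, hψ, ?_⟩
  · have := hω (ω ++ ξ) trivial
    rw [mul_assoc, ← wordProd_append, ← List.map_append]
    exact not_lt.1 this
  · rw [← e, List.map_reverse, wordProd_reverse, mul_inv_cancel_right]

theorem wordProd_map_mem_closure (ω : List ι) :
    cs.wordProd (ω.map g) ∈ Subgroup.closure (cs.simple '' Set.range g) := by
  induction ω with
  | nil => simp
  | cons i ω ih =>
    rw [List.map_cons, wordProd_cons]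
    exact mul_mem (Subgroup.subset_closure ⟨_, ⟨i, rfl⟩, rfl⟩) ih

theorem exists_wordProd_map_of_mem_closure {w : W}
    (hw : w ∈ Subgroup.closure (cs.simple '' Set.range g)) :
    ∃ ω : List ι, w = cs.wordProd (ω.map g) := by
  induction hw using Subgroup.closure_induction with
  | mem x hx =>
    obtain ⟨_, ⟨i, rfl⟩, rfl⟩ := hx
    exact ⟨[i], by simp⟩
  | one => exact ⟨[], by simp⟩
  | mul x y _ _ hx hy =>
    obtain ⟨ω, rfl⟩ := hx
    obtain ⟨ψ, rfl⟩ := hy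
    exact ⟨ω ++ ψ, by rw [List.map_append, wordProd_append]⟩
  | inv x _ hx =>
    obtain ⟨ω, rfl⟩ := hx
    exact ⟨ω.reverse, by rw [List.map_reverse, wordProd_reverse]⟩

end Words

/-! ### Elements with two right descents -/

theorem map_alternatingWord {ι : Type*} (g : ι → B) (i j : ι) (n : ℕ) :
    (alternatingWord i j n).map g = alternatingWord (g i) (g j) n := by
  induction n generalizing i j with
  | zero => rfl
  | succ n ih => rw [alternatingWord_succ, alternatingWord_succ]; simp [ih]

/-- Neighbouring letters of a reduced word differ, so two letters alternate; the trailing `j`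
decides which comes last in `ω`. -/
theorem eq_alternatingWord_of_isReduced (ω : List B) {i j : B} (h : ∀ x ∈ ω, x = i ∨ x = j)
    (hω : cs.IsReduced (ω ++ [j])) : ω = alternatingWord j i ω.length := by
  induction ω using List.reverseRecOn generalizing i j with
  | nil => rfl
  | append_singleton ω x ih =>
    obtain rfl : x = i := by
      refine (h x (by simp)).resolve_right ?_
      rintro rfl
      refine cs.not_isRightDescent_of_isReduced_concat hω ?_
      have := cs.not_isRightDescent_of_isReduced_concat (IsReduced.of_append cs hω)
      rw [wordProd_append, wordProd_singleton]
      rwa [isRightDescent_iff_not_isRightDescent_mul, simple_mul_simple_cancel_right]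
    rw [List.length_append, List.length_singleton, alternatingWord_succ, List.concat_eq_append,
      ← ih (fun y hy => (h y (by simp [hy])).symm) (IsReduced.of_append cs hω)]

theorem simple_mul_simple_pow_eq_one_of_wordProd_alternatingWord_eq {i j : B} {k : ℕ}
    (h : cs.wordProd (alternatingWord i j k) = cs.wordProd (alternatingWord j i k)) :
    (cs.simple i * cs.simple j) ^ k = 1 := by
  have e : cs.simple j * cs.simple i = (cs.simple i * cs.simple j)⁻¹ := by simp
  rw [prod_alternatingWord_eq_mul_pow, prod_alternatingWord_eq_mul_pow, e, inv_pow,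
    eq_mul_inv_iff_mul_eq, mul_assoc, ← pow_add] at h
  obtain ⟨m, rfl | rfl⟩ := Nat.even_or_odd' k
  · have h2 : 2 * m / 2 = m := by omega
    rwa [if_pos (even_two_mul m), if_pos (even_two_mul m), h2, one_mul, ← two_mul] at h
  · have h1 : ¬ Even (2 * m + 1) := by simp
    have h2 : (2 * m + 1) / 2 = m := by omega
    rw [if_neg h1, if_neg h1, h2, ← two_mul] at h
    rw [pow_succ', mul_assoc, h, simple_mul_simple_self]

/-- Split off the dihedral factor of `w` for s_i, s_j. It has alternating reduced words ending in
either letter; their equality makes its length a multiple of `M i j`, and no longer alternating word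
is reduced. -/
theorem exists_eq_mul_alternatingWord {w : W} {i j : B}
    (hi : cs.IsRightDescent w i) (hj : cs.IsRightDescent w j) :
    M i j ≠ 0 ∧ ∃ z : W, w = z * cs.wordProd (alternatingWord i j (M i j)) ∧
      cs.length w = cs.length z + M i j := by
  let g : ({i, j} : Set B) → B := Subtype.val
  obtain ⟨z, ω, hz, hω, hw⟩ := cs.exists_isMinimalLeft g w
  have hl := hz.length_mul cs hω
  rw [← hw] at hl
  have key : ∀ x y : ({i, j} : Set B), ({i, j} : Set B) = {x.1, y.1} →
      cs.IsRightDescent w y → cs.IsReduced (alternatingWord x.1 y.1 ω.length) ∧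
      cs.wordProd (ω.map g) = cs.wordProd (alternatingWord x.1 y.1 ω.length) ∧ 0 < ω.length := by
    intro x y hxy hd
    obtain ⟨ψ, hψ, e⟩ := cs.exists_isReduced_map g (ω ++ [y])
    rw [List.map_append, wordProd_append, List.map_singleton, wordProd_singleton] at e
    change cs.wordProd (ω.map g) * cs.simple y = _ at e
    have h1 := hz.length_mul cs hψ
    rw [← e, ← mul_assoc, ← hw] at h1
    rw [IsRightDescent] at hd
    have e' : cs.wordProd (ω.map g) = cs.wordProd (ψ.map g ++ [y.1]) := by
      rw [wordProd_append, wordProd_singleton, ← e, simple_mul_simple_cancel_right]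
    have h2 := cs.length_wordProd_le (ψ.map g ++ [y.1])
    rw [← e', hω.eq] at h2
    simp only [List.length_map, List.length_append, List.length_singleton] at h2
    have h3 : cs.IsReduced (ψ.map g ++ [y.1]) := by
      apply cs.isReduced_of_length_le
      rw [← e', hω.eq]
      simp only [List.length_map, List.length_append, List.length_singleton]
      omega
    have h4 := cs.eq_alternatingWord_of_isReduced (i := x.1) (j := y.1) (ψ.map g) (by
      intro a ha
      obtain ⟨b, -, rfl⟩ := List.mem_map.1 ha
      exact (Set.ext_iff.1 hxy b.1).1 b.2) h3
    rw [List.length_map] at h4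
    have h5 : ω.length = ψ.length + 1 := by omega
    have h6 : ψ.map g ++ [y.1] = alternatingWord x.1 y.1 ω.length := by
      rw [h5, alternatingWord_succ, List.concat_eq_append, ← h4]
    rw [← h6]
    exact ⟨h3, e', by omega⟩
  obtain ⟨hr, h1, hpos⟩ := key ⟨i, by simp⟩ ⟨j, by simp⟩ rfl hj
  obtain ⟨-, h2, -⟩ := key ⟨j, by simp⟩ ⟨i, by simp⟩ (Set.pair_comm i j) hi
  have hdvd := cs.dvd_of_simple_mul_simple_pow_eq_one
    (cs.simple_mul_simple_pow_eq_one_of_wordProd_alternatingWord_eq (h1.symm.trans h2))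
  have h0 : M i j ≠ 0 := by
    intro h0
    rw [h0, zero_dvd_iff] at hdvd
    omega
  have h3 : M i j = ω.length := by
    refine le_antisymm (Nat.le_of_dvd hpos hdvd) ?_
    by_contra h4
    exact cs.not_isReduced_alternatingWord i j h0 (not_le.1 h4) hr
  refine ⟨h0, z, ?_, ?_⟩
  · rw [h3, ← h1, hw]
  · rw [h3, hl]

/-! ### The presentation of a parabolic subgroup -/

section Parabolic

variable {ι G : Type*} [Group G] {N : CoxeterMatrix ι} (cg : CoxeterSystem N G) {g : ι → B}

/-- Reduced words in a subset of the generators that agree in `W` agree in the Coxeter group of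
that subset. -/
theorem wordProd_eq_of_isReduced_map (hN : ∀ i j, N i j = M (g i) (g j)) (n : ℕ) :
    ∀ ω ψ : List ι, ω.length = n → cs.IsReduced (ω.map g) → cs.IsReduced (ψ.map g) →
      cs.wordProd (ω.map g) = cs.wordProd (ψ.map g) → cg.wordProd ω = cg.wordProd ψ := by
  have hlen : ∀ ω ψ : List ι, cs.IsReduced (ω.map g) → cs.IsReduced (ψ.map g) →
      cs.wordProd (ω.map g) = cs.wordProd (ψ.map g) → ω.length = ψ.length := by
    intro ω ψ h1 h2 e
    have := h1.eq
    rwa [e, h2.eq, List.length_map, List.length_map, eq_comm] at this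
  induction n with
  | zero =>
    intro ω ψ h hω hψ e
    have h' := hlen ω ψ hω hψ e
    rw [h, eq_comm] at h'
    rw [List.length_eq_zero_iff.1 h, List.length_eq_zero_iff.1 h']
  | succ n ih =>
    -- With a common last letter, cancel it and use induction. Distinct last letters are reduced to
    -- this case by inserting two words that differ by a braid relation.
    have same : ∀ (ω ψ : List ι) (i : ι), ω.length = n → cs.IsReduced ((ω ++ [i]).map g) →
        cs.IsReduced ((ψ ++ [i]).map g) →
        cs.wordProd ((ω ++ [i]).map g) = cs.wordProd ((ψ ++ [i]).map g) →
        cg.wordProd (ω ++ [i]) = cg.wordProd (ψ ++ [i]) := by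
      intro ω ψ i h hω hψ e
      rw [List.map_append] at hω hψ e
      rw [List.map_append, wordProd_append, wordProd_append] at e
      rw [wordProd_append, wordProd_append, ih ω ψ h (IsReduced.of_append cs hω)
        (IsReduced.of_append cs hψ) (mul_right_cancel e)]
    have last : ∀ (ω : List ι) (i : ι), cs.IsReduced ((ω ++ [i]).map g) →
        cs.IsRightDescent (cs.wordProd ((ω ++ [i]).map g)) (g i) := by
      intro ω i h
      rw [List.map_append, List.map_singleton] at h ⊢
      have := cs.not_isRightDescent_of_isReduced_concat h
      rw [wordProd_append, wordProd_singleton]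
      rwa [isRightDescent_iff_not_isRightDescent_mul, simple_mul_simple_cancel_right]
    intro ω ψ h hω hψ e
    have h' := hlen ω ψ hω hψ e
    obtain rfl | ⟨ω, i, rfl⟩ := List.eq_nil_or_concat ω
    · simp at h
    obtain rfl | ⟨ψ, j, rfl⟩ := List.eq_nil_or_concat ψ
    · simp at h'
    rw [List.concat_eq_append] at *
    rw [List.concat_eq_append] at *
    have hn : ω.length = n := by simpa using h
    have hn' : ψ.length = n := by simp at h'; omega
    obtain rfl | hij := eq_or_ne i j
    · exact same ω ψ i hn hω hψ e
    have hd := last ψ j hψ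
    rw [← e] at hd
    obtain ⟨h0, z, hz, hl⟩ := cs.exists_eq_mul_alternatingWord (last ω i hω) hd
    rw [hω.eq, List.length_map] at hl
    obtain ⟨m, hm⟩ := Nat.exists_eq_succ_of_ne_zero h0
    -- The cofactor is again a product of the chosen generators, so the intermediate words can be
    -- written in `ι`.
    obtain ⟨γ, hγ⟩ : ∃ γ : List ι, z = cs.wordProd (γ.map g) := by
      refine ⟨ω ++ [i] ++ (alternatingWord i j (M (g i) (g j))).reverse, ?_⟩
      rw [List.map_append, wordProd_append, hz, List.map_reverse, wordProd_reverse,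
        map_alternatingWord, mul_inv_cancel_right]
    obtain ⟨δ, hδ, eδ⟩ := cs.exists_isReduced_map g γ
    rw [hγ, eδ] at hz
    rw [hγ, eδ, hδ.eq, List.length_map] at hl
    have hbraid := cs.wordProd_braidWord_eq (g i) (g j)
    rw [braidWord, braidWord, M.symmetric (g j)] at hbraid
    have hbraid' := cg.wordProd_braidWord_eq i j
    rw [braidWord, braidWord, N.symmetric j, hN] at hbraid'
    have e1 : cs.wordProd ((ω ++ [i]).map g) =
        cs.wordProd ((δ ++ alternatingWord i j (M (g i) (g j))).map g) := by
      rw [hz, List.map_append, wordProd_append, map_alternatingWord]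
    have e2 : cs.wordProd ((ω ++ [i]).map g) =
        cs.wordProd ((δ ++ alternatingWord j i (M (g i) (g j))).map g) := by
      rw [hz, List.map_append, wordProd_append, map_alternatingWord, hbraid]
    have r1 : cs.IsReduced ((δ ++ alternatingWord i j (M (g i) (g j))).map g) := by
      apply cs.isReduced_of_length_le
      rw [← e1, hω.eq]
      simp at hl ⊢
      omega
    have r2 : cs.IsReduced ((δ ++ alternatingWord j i (M (g i) (g j))).map g) := by
      apply cs.isReduced_of_length_le
      rw [← e2, hω.eq]
      simp at hl ⊢
      omega
    have f1 : cg.wordProd (ω ++ [i]) =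
        cg.wordProd (δ ++ alternatingWord j i (M (g i) (g j))) := by
      rw [hm, alternatingWord_succ, List.concat_eq_append, ← List.append_assoc] at r2 e2 ⊢
      exact same _ _ i hn hω r2 e2
    have f2 : cg.wordProd (ψ ++ [j]) =
        cg.wordProd (δ ++ alternatingWord i j (M (g i) (g j))) := by
      rw [e] at e1
      rw [hm, alternatingWord_succ, List.concat_eq_append, ← List.append_assoc] at r1 e1 ⊢
      exact same _ _ j hn' hψ r1 e1
    rw [f1, f2, wordProd_append, wordProd_append, hbraid']

/-- At a descent, exchange yields a reduced word ending in the letter to be cancelled;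
`wordProd_eq_of_isReduced_map` carries this equality from `W` to `G`. -/
theorem exists_isReduced_map_wordProd_eq (hN : ∀ i j, N i j = M (g i) (g j)) (ω : List ι) :
    ∃ ψ : List ι, cs.IsReduced (ψ.map g) ∧ cg.wordProd ω = cg.wordProd ψ := by
  induction ω using List.reverseRecOn with
  | nil => exact ⟨[], by simp [IsReduced], rfl⟩
  | append_singleton ω i ih =>
    obtain ⟨ψ, hψ, e⟩ := ih
    by_cases h : cs.IsRightDescent (cs.wordProd (ψ.map g)) (g i)
    · obtain ⟨ξ, h1, h2, h3⟩ := cs.exists_isReduced_map_of_isRightDescent g hψ h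
      refine ⟨ξ, h1, ?_⟩
      have h4 : cs.wordProd (ψ.map g) = cs.wordProd ((ξ ++ [i]).map g) := by
        rw [List.map_append, wordProd_append, ← h3, List.map_singleton, wordProd_singleton,
          simple_mul_simple_cancel_right]
      have h5 : cs.IsReduced ((ξ ++ [i]).map g) := by
        apply cs.isReduced_of_length_le
        rw [← h4, hψ.eq]
        simp [h2]
      rw [wordProd_append, e, cs.wordProd_eq_of_isReduced_map cg hN _ _ _ rfl hψ h5 h4,
        wordProd_append, wordProd_singleton, simple_mul_simple_cancel_right]
    · refine ⟨ψ ++ [i], ?_, by simp [wordProd_append, e]⟩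
      rw [List.map_append]
      exact cs.isReduced_concat_of_not_isRightDescent hψ h

theorem map_wordProd_of_map_simple {φ : G →* W} (hφ : ∀ i, φ (cg.simple i) = cs.simple (g i))
    (ω : List ι) : φ (cg.wordProd ω) = cs.wordProd (ω.map g) := by
  induction ω with
  | nil => simp
  | cons i ω ih => rw [wordProd_cons, map_mul, ih, hφ, List.map_cons, wordProd_cons]

/-- The Coxeter group of a subset of the generators embeds. -/
theorem injective_of_map_simple (hN : ∀ i j, N i j = M (g i) (g j)) {φ : G →* W}
    (hφ : ∀ i, φ (cg.simple i) = cs.simple (g i)) : Function.Injective φ := by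
  rw [injective_iff_map_eq_one]
  intro x hx
  obtain ⟨ω, rfl⟩ := cg.wordProd_surjective x
  obtain ⟨ψ, hψ, e⟩ := cs.exists_isReduced_map_wordProd_eq cg hN ω
  rw [e, cs.map_wordProd_of_map_simple cg hφ] at hx
  have := hψ.eq
  rw [hx, length_one, List.length_map, eq_comm, List.length_eq_zero_iff] at this
  rw [e, this, wordProd_nil]

theorem range_of_map_simple {φ : G →* W} (hφ : ∀ i, φ (cg.simple i) = cs.simple (g i)) :
    φ.range = Subgroup.closure (cs.simple '' Set.range g) := by
  ext w
  constructor
  · rintro ⟨x, rfl⟩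
    obtain ⟨ω, rfl⟩ := cg.wordProd_surjective x
    rw [cs.map_wordProd_of_map_simple cg hφ]
    exact cs.wordProd_map_mem_closure g ω
  · intro hw
    obtain ⟨ω, rfl⟩ := cs.exists_wordProd_map_of_mem_closure g hw
    exact ⟨cg.wordProd ω, cs.map_wordProd_of_map_simple cg hφ ω⟩

end Parabolic

end CoxeterSystem

/-! ### Parabolic subgroups as Coxeter systems -/

namespace Cox

/-- `(W_I, I)` is a Coxeter system. -/
theorem exists_parabolic_coxeterSystem (X : Cox.{u}) (I : Set X.B) :
    ∃ c : CoxeterSystem (restrictMatrix X.M I) (X.parabolic I),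
      ∀ i : I, (c.simple i : X.W) = X.cs.simple i := by
  -- The abstract Coxeter group of the restricted matrix maps isomorphically onto `W_I`, and its
  -- presentation is transported.
  let cg := (restrictMatrix X.M I).toCoxeterSystem
  have hl : (restrictMatrix X.M I).IsLiftable fun i : I => X.cs.simple i :=
    fun i j => X.cs.simple_mul_simple_pow i j
  let φ := cg.lift ⟨_, hl⟩
  have hφ : ∀ i : I, φ (cg.simple i) = X.cs.simple i := cg.lift_apply_simple hl
  have hinj : Function.Injective φ :=
    X.cs.injective_of_map_simple cg (fun _ _ => rfl) hφ
  have hrange : φ.range = X.parabolic I := by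
    rw [X.cs.range_of_map_simple cg hφ, Subtype.range_coe, parabolic]
  let e := (MonoidHom.ofInjective hinj).trans (MulEquiv.subgroupCongr hrange)
  exact ⟨cg.map e, hφ⟩

theorem exists_subsystem_hom (X : Cox.{u}) (I : Set X.B) :
    ∃ (c : CoxeterSystem (restrictMatrix X.M I) (X.parabolic I)) (f : X.subsystem I c ⟶ X),
      homOf f = (X.parabolic I).subtype ∧ ∀ i : I, (c.simple i : X.W) = X.cs.simple i := by
  obtain ⟨c, hc⟩ := X.exists_parabolic_coxeterSystem I
  exact ⟨c, ⟨(X.parabolic I).subtype, Subtype.val_injective, fun i => ⟨i.1, hc i⟩⟩, rfl, hc⟩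

end Cox

namespace Cox

variable {X Y Z : Cox.{u}}

/-! ### Lengths and descents under embeddings -/

theorem homOf_injective (f : X ⟶ Y) : Function.Injective (homOf f) := Emb.injective f

theorem homOf_comp (f : X ⟶ Y) (g : Y ⟶ Z) (u : X.W) : homOf (f ≫ g) u = homOf g (homOf f u) := rfl

theorem homOf_id (u : X.W) : homOf (𝟙 X) u = u := rfl

theorem exists_index_map (f : X ⟶ Y) :
    ∃ g : X.B → Y.B, (∀ i, homOf f (X.cs.simple i) = Y.cs.simple (g i)) ∧
      support f = Set.range g := by
  choose g hg using Emb.map_simple f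
  refine ⟨g, hg, ?_⟩
  ext j
  constructor
  · rintro ⟨i, hi⟩
    exact ⟨i, Y.cs.simple_injective ((hg i).symm.trans hi)⟩
  · rintro ⟨i, rfl⟩
    exact ⟨i, hg i⟩

/-- A shortening found by exchange in `Y` stays within the image letters, hence pulls back along the
injective `f`. The Coxeter matrices need not be compared. -/
theorem isReduced_map (f : X ⟶ Y) {g : X.B → Y.B}
    (hg : ∀ i, homOf f (X.cs.simple i) = Y.cs.simple (g i)) {ω : List X.B}
    (hω : X.cs.IsReduced ω) : Y.cs.IsReduced (ω.map g) := by
  induction ω using List.reverseRecOn with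
  | nil => simp [CoxeterSystem.IsReduced]
  | append_singleton ω i ih =>
    rw [List.map_append, List.map_singleton]
    have hω' := ih (CoxeterSystem.IsReduced.of_append X.cs hω)
    apply Y.cs.isReduced_concat_of_not_isRightDescent hω'
    intro hd
    obtain ⟨ψ, -, hl, e⟩ := Y.cs.exists_isReduced_map_of_isRightDescent g hω' hd
    rw [← Y.cs.map_wordProd_of_map_simple X.cs hg, ← Y.cs.map_wordProd_of_map_simple X.cs hg, ← hg,
      ← map_mul] at e
    have h1 := hω.eq
    rw [X.cs.wordProd_append, X.cs.wordProd_singleton, homOf_injective f e] at h1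
    have h2 := X.cs.length_wordProd_le ψ
    rw [List.length_append, List.length_singleton] at h1
    omega

theorem length_homOf (f : X ⟶ Y) (u : X.W) : Y.cs.length (homOf f u) = X.cs.length u := by
  obtain ⟨g, hg, -⟩ := exists_index_map f
  obtain ⟨ω, hω, rfl⟩ := X.cs.exists_isReduced u
  rw [Y.cs.map_wordProd_of_map_simple X.cs hg, (isReduced_map f hg hω).eq, hω.eq, List.length_map]

theorem exists_minimal_left (f : X ⟶ Y) (w : Y.W) :
    ∃ (z : Y.W) (u : X.W), w = z * homOf f u ∧
      ∀ v, Y.cs.length (z * homOf f v) = Y.cs.length z + X.cs.length v := by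
  obtain ⟨g, hg, -⟩ := exists_index_map f
  obtain ⟨z, ω, hz, -, e⟩ := Y.cs.exists_isMinimalLeft g w
  refine ⟨z, X.cs.wordProd ω, by rw [e, Y.cs.map_wordProd_of_map_simple X.cs hg], fun v => ?_⟩
  obtain ⟨ψ, hψ, rfl⟩ := X.cs.exists_isReduced v
  rw [Y.cs.map_wordProd_of_map_simple X.cs hg, hz.length_mul Y.cs (isReduced_map f hg hψ), hψ.eq]

/-- Write `z` as a coset-minimal element times some `u ∈ W_I`. If `u ≠ 1`, a right descent of `u`
would be a descent of `z` in `I`. -/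
theorem mem_leftReps_iff (f : X ⟶ Y) {z : Y.W} :
    z ∈ Y.leftReps (support f) ↔
      ∀ v, Y.cs.length (z * homOf f v) = Y.cs.length z + X.cs.length v := by
  constructor
  · intro hz
    obtain ⟨z', u, rfl, h⟩ := exists_minimal_left f z
    suffices u = 1 by simpa [this] using h
    by_contra hu
    obtain ⟨i, hi⟩ := X.cs.exists_rightDescent_of_ne_one hu
    obtain ⟨j, hj⟩ := Emb.map_simple f i
    refine hz (a := j) ?_ ⟨i, hj⟩
    change Y.cs.length (z' * homOf f u * Y.cs.simple j) < _
    have hj' : homOf f (X.cs.simple i) = Y.cs.simple j := hj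
    rw [← hj', mul_assoc, ← map_mul, h, h]
    exact Nat.add_lt_add_left hi _
  · rintro h j hj ⟨i, hi⟩
    have h1 : Y.cs.length (z * Y.cs.simple j) < Y.cs.length z := hj
    rw [← hi, h] at h1
    omega

theorem length_mul_homOf (f : X ⟶ Y) {z : Y.W} (hz : z ∈ Y.leftReps (support f)) (v : X.W) :
    Y.cs.length (z * homOf f v) = Y.cs.length z + X.cs.length v :=
  (mem_leftReps_iff f).1 hz v

theorem inv_mem_leftReps (I : Set Y.B) {z : Y.W} : z⁻¹ ∈ Y.leftReps I ↔ z ∈ Y.rightReps I := Iff.rfl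

theorem length_homOf_mul (f : X ⟶ Y) {z : Y.W} (hz : z ∈ Y.rightReps (support f)) (v : X.W) :
    Y.cs.length (homOf f v * z) = X.cs.length v + Y.cs.length z := by
  have := length_mul_homOf f ((inv_mem_leftReps _).2 hz) v⁻¹
  rw [map_inv, ← mul_inv_rev, Y.cs.length_inv, Y.cs.length_inv, X.cs.length_inv] at this
  rw [this, add_comm]

/-- Each representative is the other times an element of `W_I`; additivity in both directions forces
that element to have length 0. -/
theorem leftReps_unique (f : X ⟶ Y) {z z' : Y.W} (hz : z ∈ Y.leftReps (support f))
    (hz' : z' ∈ Y.leftReps (support f)) {u u' : X.W} (h : z * homOf f u = z' * homOf f u') :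
    z = z' ∧ u = u' := by
  have e : z' = z * homOf f (u * u'⁻¹) := by
    rw [map_mul, ← mul_assoc, h, map_inv, mul_inv_cancel_right]
  have e' : z = z' * homOf f (u' * u⁻¹) := by
    rw [map_mul, ← mul_assoc, ← h, map_inv, mul_inv_cancel_right]
  have h1 := length_mul_homOf f hz (u * u'⁻¹)
  have h2 := length_mul_homOf f hz' (u' * u⁻¹)
  rw [← e] at h1
  rw [← e'] at h2
  have h3 : X.cs.length (u * u'⁻¹) = 0 := by omega
  rw [X.cs.length_eq_zero_iff, mul_inv_eq_one] at h3
  subst h3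
  exact ⟨mul_right_cancel h, rfl⟩

theorem rightReps_unique (f : X ⟶ Y) {z z' : Y.W} (hz : z ∈ Y.rightReps (support f))
    (hz' : z' ∈ Y.rightReps (support f)) {u u' : X.W} (h : homOf f u * z = homOf f u' * z') :
    z = z' ∧ u = u' := by
  have h1 := congrArg (·⁻¹) h
  simp only [mul_inv_rev, ← map_inv] at h1
  have h2 := leftReps_unique f ((inv_mem_leftReps _).2 hz) ((inv_mem_leftReps _).2 hz') h1
  exact ⟨inv_injective h2.1, inv_injective h2.2⟩

theorem leftFactor_spec (f : X ⟶ Y) (w : Y.W) :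
    ∃ z ∈ Y.leftReps (support f), w = z * homOf f (leftFactor f w) :=
  (exists_leftFactor f w).choose_spec

theorem rightFactor_spec (f : X ⟶ Y) (w : Y.W) :
    ∃ z ∈ Y.rightReps (support f), w = homOf f (rightFactor f w) * z :=
  (exists_rightFactor f w).choose_spec

theorem leftFactor_mul (f : X ⟶ Y) {z : Y.W} (hz : z ∈ Y.leftReps (support f)) (u : X.W) :
    leftFactor f (z * homOf f u) = u := by
  obtain ⟨z', hz', e⟩ := leftFactor_spec f (z * homOf f u)
  exact (leftReps_unique f hz hz' e).2.symm

theorem leftFactor_inv (f : X ⟶ Y) (w : Y.W) : leftFactor f w⁻¹ = (rightFactor f w)⁻¹ := by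
  obtain ⟨z, hz, e⟩ := rightFactor_spec f w
  conv_lhs => rw [e, mul_inv_rev, ← map_inv]
  exact leftFactor_mul f ((inv_mem_leftReps _).2 hz) _

/-- This is the coefficient identity behind the duality of μ and ρ̄. -/
theorem mul_inv_mem_leftReps_iff (f : X ⟶ Y) (w : Y.W) (u : X.W) :
    w * (homOf f u)⁻¹ ∈ Y.leftReps (support f) ↔ u = leftFactor f w := by
  constructor
  · intro h
    have := leftFactor_mul f h u
    rw [inv_mul_cancel_right] at this
    exact this.symm
  · rintro rfl
    obtain ⟨z, hz, e⟩ := leftFactor_spec f w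
    rwa [← eq_mul_inv_iff_mul_eq.2 e.symm]

theorem inv_mul_mem_rightReps_iff (f : X ⟶ Y) (w : Y.W) (u : X.W) :
    (homOf f u)⁻¹ * w ∈ Y.rightReps (support f) ↔ u = rightFactor f w := by
  have := mul_inv_mem_leftReps_iff f w⁻¹ u⁻¹
  rwa [← map_inv, inv_inv, leftFactor_inv, inv_inj, ← inv_inv (homOf f u), ← mul_inv_rev,
    inv_mem_leftReps] at this

/-- Right multiplication by a generator in `I` changes only the `W_I`-factor, and lengths add. -/
theorem mem_descents_leftFactor (f : X ⟶ Y) (w : Y.W) {i : X.B} {j : Y.B}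
    (h : homOf f (X.cs.simple i) = Y.cs.simple j) :
    i ∈ X.descents (leftFactor f w) ↔ j ∈ Y.descents w := by
  obtain ⟨z, hz, e⟩ := leftFactor_spec f w
  change X.cs.length _ < _ ↔ Y.cs.length _ < Y.cs.length _
  conv_rhs => rw [e, ← h, mul_assoc, ← map_mul, length_mul_homOf f hz, length_mul_homOf f hz]
  simp

theorem descents_leftFactor_congr (f : X ⟶ Y) {w w' : Y.W} (h : Y.descents w = Y.descents w') :
    X.descents (leftFactor f w) = X.descents (leftFactor f w') := by
  ext i
  obtain ⟨j, hj⟩ := Emb.map_simple f i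
  rw [mem_descents_leftFactor f w hj, mem_descents_leftFactor f w' hj, h]

/-- If `z` is minimal in `W_I z` and `z s_j` is not minimal in `W_I z s_j`, then `z s_j = s_k z` for
some `k ∈ I`. -/
theorem exists_simple_mul_eq_mul_simple {I : Set Y.B} {z : Y.W} (hz : z ∈ Y.rightReps I) {j : Y.B}
    (hj : z * Y.cs.simple j ∉ Y.rightReps I) :
    ∃ k ∈ I, z * Y.cs.simple j = Y.cs.simple k * z := by
  obtain ⟨k, hk, hkI⟩ := Set.not_subset.1 hj
  rw [Set.notMem_compl_iff] at hkI
  refine ⟨k, hkI, ?_⟩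
  have hk' : Y.cs.IsLeftDescent (z * Y.cs.simple j) k := Y.cs.isRightDescent_inv_iff.1 hk
  have hzk : ¬ Y.cs.IsLeftDescent z k := fun h => hz (Y.cs.isRightDescent_inv_iff.2 h) hkI
  obtain ⟨ω, hω, rfl⟩ := Y.cs.exists_isReduced z
  have hk2 := Y.cs.isRightDescent_inv_iff.2 hk'
  rw [mul_inv_rev, CoxeterSystem.inv_simple, ← CoxeterSystem.wordProd_reverse,
    ← CoxeterSystem.wordProd_cons] at hk2
  obtain ⟨n, hn, e⟩ := Y.cs.exists_eraseIdx_of_isRightInversion (j :: ω.reverse)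
    ((Y.cs.isRightInversion_simple_iff_isRightDescent _ k).2 hk2)
  rw [CoxeterSystem.wordProd_cons, CoxeterSystem.wordProd_reverse] at e
  -- Deleting the letter `j` gives the claim; deleting a letter of `z` would make `k` a left descent
  -- of `z`.
  cases n with
  | zero =>
    rw [List.eraseIdx_cons_zero, CoxeterSystem.wordProd_reverse] at e
    have := congrArg (·⁻¹) e
    simp only [mul_inv_rev, inv_inv, CoxeterSystem.inv_simple] at this
    conv_rhs => rw [← this, CoxeterSystem.simple_mul_simple_cancel_left]
  | succ n =>
    rw [List.eraseIdx_cons_succ, CoxeterSystem.wordProd_cons, mul_assoc] at e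
    have e' := mul_left_cancel e
    exfalso
    apply hzk
    rw [← CoxeterSystem.isRightDescent_inv_iff, CoxeterSystem.IsRightDescent, e',
      CoxeterSystem.length_inv, hω.eq]
    have h1 := Y.cs.length_wordProd_le (ω.reverse.eraseIdx n)
    simp only [List.length_cons, Nat.add_lt_add_iff_right] at hn
    have h2 := List.length_eraseIdx_add_one hn
    rw [List.length_reverse] at h2
    omega

/-- If z s_j is still minimal, additivity makes `u` irrelevant to whether `j` is a descent of uz.
Otherwise z s_j = s_k z with k ∈ I, and `j` is a descent of uz exactly when s_k is one of `u`. -/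
theorem descents_homOf_mul_congr (f : X ⟶ Y) {z : Y.W} (hz : z ∈ Y.rightReps (support f))
    {u u' : X.W} (h : X.descents u = X.descents u') :
    Y.descents (homOf f u * z) = Y.descents (homOf f u' * z) := by
  ext j
  by_cases hj : z * Y.cs.simple j ∈ Y.rightReps (support f)
  · have key : ∀ v : X.W, j ∈ Y.descents (homOf f v * z) ↔ j ∈ Y.descents z := by
      intro v
      change Y.cs.length _ < _ ↔ Y.cs.length _ < _
      rw [mul_assoc, length_homOf_mul f hj, length_homOf_mul f hz, Nat.add_lt_add_iff_left]
    rw [key, key]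
  · obtain ⟨k, ⟨i, hi⟩, e⟩ := exists_simple_mul_eq_mul_simple hz hj
    have key : ∀ v : X.W, j ∈ Y.descents (homOf f v * z) ↔ i ∈ X.descents v := by
      intro v
      change Y.cs.length _ < _ ↔ X.cs.length _ < _
      rw [mul_assoc, e, ← hi, ← mul_assoc, ← map_mul, length_homOf_mul f hz, length_homOf_mul f hz,
        Nat.add_lt_add_iff_right]
    rw [key, key, h]

/-! ### Factors along composites and identities -/

theorem mul_homOf_mem_leftReps (f : X ⟶ Y) (g : Y ⟶ Z) {z : Z.W} (hz : z ∈ Z.leftReps (support g))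
    {y : Y.W} (hy : y ∈ Y.leftReps (support f)) :
    z * homOf g y ∈ Z.leftReps (support (f ≫ g)) := by
  rw [mem_leftReps_iff]
  intro v
  rw [homOf_comp, mul_assoc, ← map_mul, length_mul_homOf g hz, length_mul_homOf f hy,
    length_mul_homOf g hz, add_assoc]

theorem leftFactor_comp (f : X ⟶ Y) (g : Y ⟶ Z) (w : Z.W) :
    leftFactor (f ≫ g) w = leftFactor f (leftFactor g w) := by
  obtain ⟨z, hz, e⟩ := leftFactor_spec g w
  obtain ⟨y, hy, e'⟩ := leftFactor_spec f (leftFactor g w)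
  have : w = z * homOf g y * homOf (f ≫ g) (leftFactor f (leftFactor g w)) := by
    rw [homOf_comp, mul_assoc, ← map_mul, ← e', ← e]
  conv_lhs => rw [this]
  exact leftFactor_mul _ (mul_homOf_mem_leftReps f g hz hy) _

theorem rightFactor_comp (f : X ⟶ Y) (g : Y ⟶ Z) (w : Z.W) :
    rightFactor (f ≫ g) w = rightFactor f (rightFactor g w) := by
  apply inv_injective
  rw [← leftFactor_inv, ← leftFactor_inv, ← leftFactor_inv, leftFactor_comp]

theorem leftFactor_id (w : X.W) : leftFactor (𝟙 X) w = w := by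
  have h1 : (1 : X.W) ∈ X.leftReps (support (𝟙 X)) := by
    rw [mem_leftReps_iff]
    simp [homOf_id]
  simpa [homOf_id] using leftFactor_mul (𝟙 X) h1 w

theorem rightFactor_id (w : X.W) : rightFactor (𝟙 X) w = w := by
  apply inv_injective
  rw [← leftFactor_inv, leftFactor_id]

theorem existsUnique_factorization (f : X ⟶ Y) (w : Y.W) :
    (∃! p : X.W × Y.W, p.2 ∈ Y.rightReps (support f) ∧ w = homOf f p.1 * p.2) ∧
      (∃! p : Y.W × X.W, p.1 ∈ Y.leftReps (support f) ∧ w = p.1 * homOf f p.2) := by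
  constructor
  · obtain ⟨z, hz, e⟩ := rightFactor_spec f w
    refine ⟨(_, z), ⟨hz, e⟩, ?_⟩
    rintro ⟨u, z'⟩ ⟨hz', e'⟩
    obtain ⟨h1, h2⟩ := rightReps_unique f hz' hz (e'.symm.trans e)
    exact Prod.ext h2 h1
  · obtain ⟨z, hz, e⟩ := leftFactor_spec f w
    refine ⟨(z, _), ⟨hz, e⟩, ?_⟩
    rintro ⟨z', u⟩ ⟨hz', e'⟩
    obtain ⟨h1, h2⟩ := leftReps_unique f hz' hz (e'.symm.trans e)
    exact Prod.ext h1 h2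

end Cox

theorem DualMaps.of_eq {A A' C C' : Type*} [AddCommGroup A] [AddCommGroup A'] [AddCommGroup C]
    [AddCommGroup C'] [Module ℤ A] [Module ℤ A'] [Module ℤ C] [Module ℤ C']
    {p : A →ₗ[ℤ] A' →ₗ[ℤ] ℤ} {q : C →ₗ[ℤ] C' →ₗ[ℤ] ℤ} {f : A →ₗ[ℤ] C} {g : C' →ₗ[ℤ] A'}
    (h : q ∘ₗ f = (LinearMap.lcomp ℤ ℤ g) ∘ₗ p) : DualMaps p q f g :=
  fun a c' => LinearMap.congr_fun (LinearMap.congr_fun h a) c'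

namespace Cox

variable {X Y Z : Cox.{u}}

/-! ### Coefficients and the form on the group algebra -/

theorem linearMap_ext {N : Type*} [AddCommGroup N] [Module ℤ N]
    {F G : MonoidAlgebra ℤ X.W →ₗ[ℤ] N} (h : ∀ w, F (single w 1) = G (single w 1)) : F = G := by
  apply lhom_ext'
  intro w
  ext
  exact h w

theorem form_apply_single (x : MonoidAlgebra ℤ X.W) (w : X.W) :
    X.form x (single w 1) = x.coeff w := by
  rw [form, LinearMap.mk₂_apply, finsum_eq_single _ w]
  · simp
  · intro v hv
    simp [hv.symm]

theorem form_comm (x y : MonoidAlgebra ℤ X.W) : X.form x y = X.form y x := by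
  rw [form, LinearMap.mk₂_apply, LinearMap.mk₂_apply]
  exact finsum_congr fun w => mul_comm _ _

theorem form_flip : X.form.flip = X.form := by
  refine LinearMap.ext fun x => LinearMap.ext fun y => ?_
  exact form_comm y x

theorem eq_of_form_eq {x y : MonoidAlgebra ℤ X.W} (h : ∀ z, X.form x z = X.form y z) : x = y := by
  ext w
  rw [← form_apply_single, h, form_apply_single]

theorem form_bijective : Function.Bijective X.form := by
  constructor
  · intro x y h
    exact eq_of_form_eq fun z => by rw [h]
  · intro F
    have := Fintype.ofFinite X.W
    refine ⟨∑ w, F (single w 1) • single w 1, linearMap_ext fun w => ?_⟩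
    rw [form_apply_single]
    classical simp [coeff_sum, Finsupp.single_apply]

instance : X.form.IsPerfPair where
  bijective_left := form_bijective
  bijective_right := by rw [form_flip]; exact form_bijective

/-- Inside a finitely generated free ℤ-module, Σ(W) is itself finitely generated and free, hence
reflexive. -/
theorem evalPairing_isPerfPair : X.evalPairing.IsPerfPair where
  bijective_left := Module.bijective_dual_eval ℤ _
  bijective_right := Function.bijective_id

open Classical in
theorem coeff_setSum (A : Set X.W) (w : X.W) : (X.setSum A).coeff w = if w ∈ A then 1 else 0 := by
  simp [setSum, coeff_sum, Finsupp.single_apply]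

theorem dualMaps_of_single {F : MonoidAlgebra ℤ X.W →ₗ[ℤ] MonoidAlgebra ℤ Y.W}
    {G : MonoidAlgebra ℤ Y.W →ₗ[ℤ] MonoidAlgebra ℤ X.W}
    (h : ∀ u w, Y.form (F (single u 1)) (single w 1) = X.form (single u 1) (G (single w 1))) :
    DualMaps X.form Y.form F G :=
  DualMaps.of_eq (linearMap_ext fun u => linearMap_ext fun w => h u w)

theorem dualMaps_symm {F : MonoidAlgebra ℤ X.W →ₗ[ℤ] MonoidAlgebra ℤ Y.W}
    {G : MonoidAlgebra ℤ Y.W →ₗ[ℤ] MonoidAlgebra ℤ X.W} (h : DualMaps X.form Y.form F G) :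
    DualMaps Y.form X.form G F :=
  fun x y => by rw [form_comm, ← h, form_comm]

/-! ### The four maps on basis elements, and their dualities -/

theorem rho_single (f : X ⟶ Y) (w : Y.W) :
    rho f (single w 1) = single (rightFactor f w) 1 := mapDomainLinearMap_single _ _ _

theorem rhoBar_single (f : X ⟶ Y) (w : Y.W) :
    rhoBar f (single w 1) = single (leftFactor f w) 1 := mapDomainLinearMap_single _ _ _

theorem invMap_single (w : X.W) : X.invMap (single w 1) = single w⁻¹ 1 :=
  mapDomainLinearMap_single _ _ _

theorem mu_single (f : X ⟶ Y) (u : X.W) :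
    mu f (single u 1) = ∑ z ∈ (Y.leftReps (support f)).toFinite.toFinset,
      single (z * homOf f u) 1 := by
  simp [mu, setSum, Finset.sum_mul, single_mul_single]

theorem muBar_single (f : X ⟶ Y) (u : X.W) :
    muBar f (single u 1) = ∑ z ∈ (Y.rightReps (support f)).toFinite.toFinset,
      single (homOf f u * z) 1 := by
  simp [muBar, setSum, Finset.mul_sum, single_mul_single]

theorem dualMaps_mu_rhoBar (f : X ⟶ Y) : DualMaps X.form Y.form (mu f) (rhoBar f) := by
  classical
  apply dualMaps_of_single
  intro u w
  rw [rhoBar_single, form_single, mu_single, map_sum, LinearMap.sum_apply]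
  simp only [form_single, ← eq_mul_inv_iff_mul_eq, Finset.sum_ite_eq', Set.Finite.mem_toFinset,
    mul_inv_mem_leftReps_iff]

theorem dualMaps_muBar_rho (f : X ⟶ Y) : DualMaps X.form Y.form (muBar f) (rho f) := by
  classical
  apply dualMaps_of_single
  intro u w
  rw [rho_single, form_single, muBar_single, map_sum, LinearMap.sum_apply]
  simp only [form_single, ← eq_inv_mul_iff_mul_eq, Finset.sum_ite_eq', Set.Finite.mem_toFinset,
    inv_mul_mem_rightReps_iff]

theorem dualMaps_invMap : DualMaps X.form X.form X.invMap X.invMap := by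
  classical
  apply dualMaps_of_single
  intro u w
  simp only [invMap_single, form_single, inv_eq_iff_eq_inv]

theorem invMap_invMap (x : MonoidAlgebra ℤ X.W) : X.invMap (X.invMap x) = x := by
  have : X.invMap ∘ₗ X.invMap = LinearMap.id := linearMap_ext fun w => by
    simp [invMap_single]
  exact LinearMap.congr_fun this x

theorem invMap_bijective : Function.Bijective X.invMap :=
  Function.Involutive.bijective invMap_invMap

theorem invMap_comp_rho (f : X ⟶ Y) : X.invMap ∘ₗ rho f = rhoBar f ∘ₗ Y.invMap :=
  linearMap_ext fun w => by
    simp only [LinearMap.comp_apply, rho_single, rhoBar_single, invMap_single, leftFactor_inv]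

/-- This is the transpose of `invMap_comp_rho`; since the form is nondegenerate, identities may be
checked on adjoints. -/
theorem invMap_comp_mu (f : X ⟶ Y) : Y.invMap ∘ₗ mu f = muBar f ∘ₗ X.invMap := by
  refine LinearMap.ext fun x => ?_
  refine eq_of_form_eq fun z => ?_
  simp only [LinearMap.comp_apply]
  rw [dualMaps_invMap, dualMaps_mu_rhoBar, dualMaps_muBar_rho, dualMaps_invMap]
  exact congrArg _ (LinearMap.congr_fun (invMap_comp_rho f) z).symm

theorem rho_id : rho (𝟙 X) = LinearMap.id :=
  linearMap_ext fun w => by rw [rho_single, rightFactor_id]; rfl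

theorem rhoBar_id : rhoBar (𝟙 X) = LinearMap.id :=
  linearMap_ext fun w => by rw [rhoBar_single, leftFactor_id]; rfl

theorem rho_comp (f : X ⟶ Y) (g : Y ⟶ Z) : rho (f ≫ g) = rho f ∘ₗ rho g :=
  linearMap_ext fun w => by
    simp only [LinearMap.comp_apply, rho_single, rightFactor_comp]

theorem rhoBar_comp (f : X ⟶ Y) (g : Y ⟶ Z) : rhoBar (f ≫ g) = rhoBar f ∘ₗ rhoBar g :=
  linearMap_ext fun w => by
    simp only [LinearMap.comp_apply, rhoBar_single, leftFactor_comp]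

theorem mu_id : mu (𝟙 X) = LinearMap.id := by
  refine LinearMap.ext fun x => ?_
  exact eq_of_form_eq fun z => by rw [dualMaps_mu_rhoBar, rhoBar_id]; rfl

theorem muBar_id : muBar (𝟙 X) = LinearMap.id := by
  refine LinearMap.ext fun x => ?_
  exact eq_of_form_eq fun z => by rw [dualMaps_muBar_rho, rho_id]; rfl

theorem mu_comp (f : X ⟶ Y) (g : Y ⟶ Z) : mu (f ≫ g) = mu g ∘ₗ mu f := by
  refine LinearMap.ext fun x => ?_
  refine eq_of_form_eq fun z => ?_
  rw [LinearMap.comp_apply, dualMaps_mu_rhoBar, dualMaps_mu_rhoBar g, dualMaps_mu_rhoBar f,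
    rhoBar_comp, LinearMap.comp_apply]

theorem muBar_comp (f : X ⟶ Y) (g : Y ⟶ Z) : muBar (f ≫ g) = muBar g ∘ₗ muBar f := by
  refine LinearMap.ext fun x => ?_
  refine eq_of_form_eq fun z => ?_
  rw [LinearMap.comp_apply, dualMaps_muBar_rho, dualMaps_muBar_rho g, dualMaps_muBar_rho f,
    rho_comp, LinearMap.comp_apply]

/-! ### The descent algebra -/

/-- The set of descent sets of elements of `W`. -/
noncomputable def descentSets (X : Cox.{u}) : Finset (Set X.B) :=
  (Set.finite_range X.descents).toFinset

/-- An element with a given descent set. -/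
noncomputable def descentRep (X : Cox.{u}) : Set X.B → X.W := Function.invFun X.descents

theorem descents_descentRep {J : Set X.B} (hJ : J ∈ X.descentSets) :
    X.descents (X.descentRep J) = J :=
  Function.invFun_eq ((Set.finite_range X.descents).mem_toFinset.1 hJ)

theorem descents_mem_descentSets (w : X.W) : X.descents w ∈ X.descentSets :=
  (Set.finite_range X.descents).mem_toFinset.2 ⟨w, rfl⟩

theorem coeff_eq_of_mem_descentAlg {x : MonoidAlgebra ℤ X.W} (hx : x ∈ X.descentAlg) {w w' : X.W}
    (h : X.descents w = X.descents w') : x.coeff w = x.coeff w' := by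
  classical
  induction hx using Submodule.span_induction with
  | mem x hx =>
    obtain ⟨J, rfl⟩ := hx
    simp only [descentSum, coeff_setSum]
    exact if_congr (by rw [Set.mem_ofPred_eq, Set.mem_ofPred_eq, h]) rfl rfl
  | zero => simp
  | add x y _ _ hx hy => simp [hx, hy]
  | smul a x _ hx => simp only [coeff_smul, Finsupp.smul_apply, hx]

/-- Only descent sets that occur enter the sum, so it need not be known that every `J ⊆ S` occurs.
-/
theorem eq_sum_descentSum {x : MonoidAlgebra ℤ X.W}
    (hx : ∀ w w', X.descents w = X.descents w' → x.coeff w = x.coeff w') :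
    x = ∑ J ∈ X.descentSets, x.coeff (X.descentRep J) • X.descentSum J := by
  classical
  ext w
  simp only [coeff_sum, coeff_smul, Finsupp.finsetSum_apply, Finsupp.smul_apply, descentSum,
    coeff_setSum, Set.mem_ofPred_eq, smul_eq_mul, mul_ite, mul_one, mul_zero, Finset.sum_ite_eq,
    descents_mem_descentSets, if_true]
  exact hx _ _ (descents_descentRep (descents_mem_descentSets w)).symm

theorem mem_descentAlg_iff {x : MonoidAlgebra ℤ X.W} :
    x ∈ X.descentAlg ↔ ∀ w w', X.descents w = X.descents w' → x.coeff w = x.coeff w' := by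
  constructor
  · intro hx w w' h
    exact coeff_eq_of_mem_descentAlg hx h
  · intro hx
    rw [eq_sum_descentSum hx]
    exact sum_mem fun J _ => Submodule.smul_mem _ _ (X.descentSum_mem J)

theorem chi_apply (y : MonoidAlgebra ℤ X.W) (x : X.descentAlg) :
    X.chi y x = X.form (X.iota x) y := rfl

theorem chi_surjective : Function.Surjective X.chi := by
  intro F
  -- One representative per descent class suffices: pairing it with an element of Σ(W) reads off the
  -- coefficient of D_J.
  refine ⟨∑ J ∈ X.descentSets, F ⟨X.descentSum J, X.descentSum_mem J⟩ •
    single (X.descentRep J) 1, ?_⟩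
  ext ⟨x, hx⟩
  have e : (⟨x, hx⟩ : X.descentAlg) = ∑ J ∈ X.descentSets, x.coeff (X.descentRep J) •
      ⟨X.descentSum J, X.descentSum_mem J⟩ := by
    apply Subtype.ext
    refine (eq_sum_descentSum (mem_descentAlg_iff.1 hx)).trans ?_
    simp
  conv_rhs => rw [e, map_sum]
  rw [chi_apply, map_sum]
  refine Finset.sum_congr rfl fun J _ => ?_
  rw [map_smul, map_smul, form_apply_single, smul_eq_mul, smul_eq_mul, mul_comm]
  rfl

/-! ### Induced maps on Σ and Σ^*, and functoriality -/

theorem mu_mem_descentAlg (f : X ⟶ Y) {x : MonoidAlgebra ℤ X.W} (hx : x ∈ X.descentAlg) :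
    mu f x ∈ Y.descentAlg := by
  rw [mem_descentAlg_iff] at hx ⊢
  intro w w' h
  rw [← form_apply_single, ← form_apply_single, dualMaps_mu_rhoBar, dualMaps_mu_rhoBar,
    rhoBar_single, rhoBar_single, form_apply_single, form_apply_single]
  exact hx _ _ (descents_leftFactor_congr f h)

/-- The coefficient of ρ(x) at `u` is the sum over `z ∈ ^I W` of those of `x` at `uz`, and each
summand depends only on D(u). -/
theorem rho_mem_descentAlg (f : X ⟶ Y) {x : MonoidAlgebra ℤ Y.W} (hx : x ∈ Y.descentAlg) :
    rho f x ∈ X.descentAlg := by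
  rw [mem_descentAlg_iff] at hx ⊢
  intro w w' h
  rw [← form_apply_single, ← form_apply_single, dualMaps_symm (dualMaps_muBar_rho f),
    dualMaps_symm (dualMaps_muBar_rho f), muBar_single, muBar_single, map_sum, map_sum]
  refine Finset.sum_congr rfl fun z hz => ?_
  rw [form_apply_single, form_apply_single]
  exact hx _ _ (descents_homOf_mul_congr f ((Set.Finite.mem_toFinset _).1 hz) h)

/-- The restriction of `μ` to the descent algebras. -/
noncomputable def muDescent (f : X ⟶ Y) : X.descentAlg →ₗ[ℤ] Y.descentAlg :=
  (mu f).restrict fun _ => mu_mem_descentAlg f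

/-- The restriction of `ρ` to the descent algebras. -/
noncomputable def rhoDescent (f : X ⟶ Y) : Y.descentAlg →ₗ[ℤ] X.descentAlg :=
  (rho f).restrict fun _ => rho_mem_descentAlg f

/-- The map induced by `μ̄` on the duals of the descent algebras. -/
noncomputable def muDual (f : X ⟶ Y) : X.dualDescent →ₗ[ℤ] Y.dualDescent := (rhoDescent f).dualMap

/-- The map induced by `ρ̄` on the duals of the descent algebras. -/
noncomputable def rhoDual (f : X ⟶ Y) : Y.dualDescent →ₗ[ℤ] X.dualDescent := (muDescent f).dualMap

/-- As χ and `muDual` are transposes of the inclusion and of the restricted ρ, the square is the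
duality of μ̄ and ρ evaluated on Σ(W). -/
theorem chi_comp_muBar (f : X ⟶ Y) : Y.chi ∘ₗ muBar f = muDual f ∘ₗ X.chi := by
  refine LinearMap.ext fun x => LinearMap.ext fun y => ?_
  exact (dualMaps_symm (dualMaps_muBar_rho f) _ _).symm

theorem chi_comp_rhoBar (f : X ⟶ Y) : X.chi ∘ₗ rhoBar f = rhoDual f ∘ₗ Y.chi := by
  refine LinearMap.ext fun x => LinearMap.ext fun y => ?_
  exact (dualMaps_mu_rhoBar f _ _).symm

theorem chi'_comp_mu (f : X ⟶ Y) : Y.chi' ∘ₗ mu f = muDual f ∘ₗ X.chi' := by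
  rw [chi', chi', LinearMap.comp_assoc, invMap_comp_mu, ← LinearMap.comp_assoc, chi_comp_muBar,
    LinearMap.comp_assoc]

theorem chi'_comp_rho (f : X ⟶ Y) : X.chi' ∘ₗ rho f = rhoDual f ∘ₗ Y.chi' := by
  rw [chi', chi', LinearMap.comp_assoc, invMap_comp_rho, ← LinearMap.comp_assoc, chi_comp_rhoBar,
    LinearMap.comp_assoc]

theorem muDescent_id : muDescent (𝟙 X) = LinearMap.id := by
  refine LinearMap.ext fun x => ?_
  exact Subtype.ext (LinearMap.congr_fun mu_id x.1)

theorem rhoDescent_id : rhoDescent (𝟙 X) = LinearMap.id := by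
  refine LinearMap.ext fun x => ?_
  exact Subtype.ext (LinearMap.congr_fun rho_id x.1)

theorem muDescent_comp (f : X ⟶ Y) (g : Y ⟶ Z) :
    muDescent (f ≫ g) = muDescent g ∘ₗ muDescent f := by
  refine LinearMap.ext fun x => ?_
  exact Subtype.ext (LinearMap.congr_fun (mu_comp f g) x.1)

theorem rhoDescent_comp (f : X ⟶ Y) (g : Y ⟶ Z) :
    rhoDescent (f ≫ g) = rhoDescent f ∘ₗ rhoDescent g := by
  refine LinearMap.ext fun x => ?_
  exact Subtype.ext (LinearMap.congr_fun (rho_comp f g) x.1)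

theorem isRep_mu : IsRep (fun X : Cox.{u} => MonoidAlgebra ℤ X.W) (fun f => mu f) :=
  ⟨fun _ => mu_id, mu_comp⟩

theorem isRep_muBar : IsRep (fun X : Cox.{u} => MonoidAlgebra ℤ X.W) (fun f => muBar f) :=
  ⟨fun _ => muBar_id, muBar_comp⟩

theorem isRep_muDescent : IsRep (fun X : Cox.{u} => X.descentAlg) (fun f => muDescent f) :=
  ⟨fun _ => muDescent_id, muDescent_comp⟩

theorem isRep_muDual : IsRep (fun X : Cox.{u} => X.dualDescent) (fun f => muDual f) :=
  ⟨fun _ => by rw [muDual, rhoDescent_id]; rfl, fun f g => by rw [muDual, rhoDescent_comp]; rfl⟩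

theorem isRep_rho :
    IsRep (fun X : Cox.{u}ᵒᵖ => MonoidAlgebra ℤ X.unop.W) (fun f => rho f.unop) :=
  ⟨fun _ => rho_id, fun f g => rho_comp g.unop f.unop⟩

theorem isRep_rhoBar :
    IsRep (fun X : Cox.{u}ᵒᵖ => MonoidAlgebra ℤ X.unop.W) (fun f => rhoBar f.unop) :=
  ⟨fun _ => rhoBar_id, fun f g => rhoBar_comp g.unop f.unop⟩

theorem isRep_rhoDescent :
    IsRep (fun X : Cox.{u}ᵒᵖ => X.unop.descentAlg) (fun f => rhoDescent f.unop) :=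
  ⟨fun _ => rhoDescent_id, fun f g => rhoDescent_comp g.unop f.unop⟩

theorem isRep_rhoDual :
    IsRep (fun X : Cox.{u}ᵒᵖ => X.unop.dualDescent) (fun f => rhoDual f.unop) :=
  ⟨fun X => by rw [unop_id, rhoDual, muDescent_id]; rfl,
    fun f g => by rw [unop_comp, rhoDual, muDescent_comp]; rfl⟩

end Cox

/-- A family of linear maps commuting with the maps of two representations is a natural
transformation. -/
theorem IsRep.exists_natTrans {C : Type v} [Category.{w} C] {obj obj' : C → Type u}
    [∀ X, AddCommGroup (obj X)] [∀ X, Module ℤ (obj X)] [∀ X, AddCommGroup (obj' X)]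
    [∀ X, Module ℤ (obj' X)] {map : ∀ {X Y : C}, (X ⟶ Y) → (obj X →ₗ[ℤ] obj Y)}
    {map' : ∀ {X Y : C}, (X ⟶ Y) → (obj' X →ₗ[ℤ] obj' Y)} (h : IsRep obj map)
    (h' : IsRep obj' map') (t : ∀ X, obj X →ₗ[ℤ] obj' X)
    (ht : ∀ {X Y : C} (f : X ⟶ Y), t Y ∘ₗ map f = map' f ∘ₗ t X) :
    ∃ T : h.functor ⟶ h'.functor, ∀ X, T.app X = ModuleCat.ofHom (t X) :=
  ⟨{ app := fun X => ModuleCat.ofHom (t X)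
     naturality := fun X Y f => by
      change ModuleCat.ofHom (map f) ≫ ModuleCat.ofHom (t Y) =
        ModuleCat.ofHom (t X) ≫ ModuleCat.ofHom (map' f)
      rw [← ModuleCat.ofHom_comp, ← ModuleCat.ofHom_comp, ht] }, fun _ => rfl⟩

theorem theorem2 :
    -- every `I ⊆ S` gives a parabolic subsystem `(W_I, I)`, whose inclusion is a morphism
    (∀ (X : Cox.{u}) (I : Set X.B),
      ∃ (c : CoxeterSystem (Cox.restrictMatrix X.M I) (X.parabolic I))
        (f : X.subsystem I c ⟶ X), Cox.homOf f = (X.parabolic I).subtype ∧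
        ∀ i : I, (c.simple i : X.W) = X.cs.simple i) ∧
    -- the factors `w_I` and `_I w` are uniquely determined
    (∀ (X Y : Cox.{u}) (f : X ⟶ Y) (w : Y.W),
      (∃! p : X.W × Y.W, p.2 ∈ Y.rightReps (Cox.support f) ∧ w = Cox.homOf f p.1 * p.2) ∧
      (∃! p : Y.W × X.W, p.1 ∈ Y.leftReps (Cox.support f) ∧ w = p.1 * Cox.homOf f p.2)) ∧
    -- the maps on `Σ` and on `Σ^*`
    ∃ (muS : ∀ {X Y : Cox.{u}}, (X ⟶ Y) → (X.descentAlg →ₗ[ℤ] Y.descentAlg))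
      (rhoS : ∀ {X Y : Cox.{u}}, (X ⟶ Y) → (Y.descentAlg →ₗ[ℤ] X.descentAlg))
      (muD : ∀ {X Y : Cox.{u}}, (X ⟶ Y) → (X.dualDescent →ₗ[ℤ] Y.dualDescent))
      (rhoD : ∀ {X Y : Cox.{u}}, (X ⟶ Y) → (Y.dualDescent →ₗ[ℤ] X.dualDescent)),
      -- the six squares of the diagram commute
      (∀ (X Y : Cox.{u}) (f : X ⟶ Y),
        Y.iota ∘ₗ muS f = Cox.mu f ∘ₗ X.iota ∧
        Y.invMap ∘ₗ Cox.mu f = Cox.muBar f ∘ₗ X.invMap ∧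
        Y.chi ∘ₗ Cox.muBar f = muD f ∘ₗ X.chi ∧
        X.iota ∘ₗ rhoS f = Cox.rho f ∘ₗ Y.iota ∧
        X.invMap ∘ₗ Cox.rho f = Cox.rhoBar f ∘ₗ Y.invMap ∧
        X.chi ∘ₗ Cox.rhoBar f = rhoD f ∘ₗ Y.chi) ∧
      -- the horizontal arrows are injective, bijective, surjective
      (∀ X : Cox.{u}, Function.Injective X.iota ∧ Function.Bijective X.invMap ∧
        Function.Surjective X.chi) ∧
      -- rotating the diagram by 180 degrees gives the dual diagram
      (∀ X : Cox.{u}, X.form.IsPerfPair ∧ X.evalPairing.IsPerfPair ∧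
        DualMaps X.evalPairing X.form X.iota X.chi ∧
        DualMaps X.form X.form X.invMap X.invMap) ∧
      (∀ (X Y : Cox.{u}) (f : X ⟶ Y),
        DualMaps X.evalPairing Y.evalPairing (muS f) (rhoD f) ∧
        DualMaps Y.evalPairing X.evalPairing (rhoS f) (muD f) ∧
        DualMaps X.form Y.form (Cox.mu f) (Cox.rhoBar f) ∧
        DualMaps Y.form X.form (Cox.rho f) (Cox.muBar f) ∧
        DualMaps X.form Y.form (Cox.muBar f) (Cox.rho f) ∧
        DualMaps Y.form X.form (Cox.rhoBar f) (Cox.mu f)) ∧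
      -- representations `Σ`, `Ω`, `Ω^*`, `Σ^*` of `Cox`, and the natural transformations
      (∃ (hS : IsRep (fun X : Cox.{u} => X.descentAlg) (fun f => muS f))
         (hO : IsRep (fun X : Cox.{u} => MonoidAlgebra ℤ X.W) (fun f => Cox.mu f))
         (hO' : IsRep (fun X : Cox.{u} => MonoidAlgebra ℤ X.W) (fun f => Cox.muBar f))
         (hD : IsRep (fun X : Cox.{u} => X.dualDescent) (fun f => muD f)),
        (∃ t : hS.functor ⟶ hO.functor, ∀ X, t.app X = ModuleCat.ofHom X.iota) ∧
        (∃ t : hO'.functor ⟶ hD.functor, ∀ X, t.app X = ModuleCat.ofHom X.chi) ∧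
        (∃ t : hO.functor ⟶ hD.functor, ∀ X, t.app X = ModuleCat.ofHom X.chi')) ∧
      -- the same for the opposite category
      (∃ (hS : IsRep (fun X : Cox.{u}ᵒᵖ => X.unop.descentAlg) (fun f => rhoS f.unop))
         (hO : IsRep (fun X : Cox.{u}ᵒᵖ => MonoidAlgebra ℤ X.unop.W) (fun f => Cox.rho f.unop))
         (hO' : IsRep (fun X : Cox.{u}ᵒᵖ => MonoidAlgebra ℤ X.unop.W)
           (fun f => Cox.rhoBar f.unop))
         (hD : IsRep (fun X : Cox.{u}ᵒᵖ => X.unop.dualDescent) (fun f => rhoD f.unop)),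
        (∃ t : hS.functor ⟶ hO.functor, ∀ X, t.app X = ModuleCat.ofHom X.unop.iota) ∧
        (∃ t : hO'.functor ⟶ hD.functor, ∀ X, t.app X = ModuleCat.ofHom X.unop.chi) ∧
        (∃ t : hO.functor ⟶ hD.functor, ∀ X, t.app X = ModuleCat.ofHom X.unop.chi')) := by
  refine ⟨Cox.exists_subsystem_hom, fun X Y f w => Cox.existsUnique_factorization f w,
    Cox.muDescent, Cox.rhoDescent, Cox.muDual, Cox.rhoDual, ?_, ?_, ?_, ?_, ?_, ?_⟩
  · intro X Y f
    exact ⟨rfl, Cox.invMap_comp_mu f, Cox.chi_comp_muBar f, rfl, Cox.invMap_comp_rho f,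
      Cox.chi_comp_rhoBar f⟩
  · intro X
    exact ⟨Subtype.val_injective, Cox.invMap_bijective, Cox.chi_surjective⟩
  · intro X
    exact ⟨inferInstance, Cox.evalPairing_isPerfPair, fun _ _ => rfl, Cox.dualMaps_invMap⟩
  · intro X Y f
    -- The dualities between Σ and Σ^* hold by definition, the maps on Σ^* being transposes.
    exact ⟨fun _ _ => rfl, fun _ _ => rfl, Cox.dualMaps_mu_rhoBar f,
      Cox.dualMaps_symm (Cox.dualMaps_muBar_rho f), Cox.dualMaps_muBar_rho f,
      Cox.dualMaps_symm (Cox.dualMaps_mu_rhoBar f)⟩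
  · exact ⟨Cox.isRep_muDescent, Cox.isRep_mu, Cox.isRep_muBar, Cox.isRep_muDual,
      IsRep.exists_natTrans _ _ _ fun _ => rfl,
      IsRep.exists_natTrans _ _ _ fun f => Cox.chi_comp_muBar f,
      IsRep.exists_natTrans _ _ _ fun f => Cox.chi'_comp_mu f⟩
  · exact ⟨Cox.isRep_rhoDescent, Cox.isRep_rho, Cox.isRep_rhoBar, Cox.isRep_rhoDual,
      IsRep.exists_natTrans _ _ _ fun _ => rfl,
      IsRep.exists_natTrans _ _ _ fun f => Cox.chi_comp_rhoBar f.unop,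
      IsRep.exists_natTrans _ _ _ fun f => Cox.chi'_comp_rho f.unop⟩
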